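/- Let $G=(V,E)$ be a finite simple graph with a (not necessarily proper) colouring $\omega:V\to C$ from a finite nonempty colour-set $C$. A move $(v,d)$, with $v\in V$ and $d\in C$, gives colour $d$ to all vertices in the monochromatic component of $v$ (the connected component of $v$ in the subgraph of all edges whose two ends currently have the same colour). Let $m_G(G,\omega,d)$ be the minimum number of moves that give all vertices of $G$ colour $d$, and let $m_G(G,\omega)=\min_{d\in C}m_G(G,\omega,d)$. **Theorem.** Let $p$ be a polynomial with real coefficients, and let $\mathcal G_p$ be the class of finite graphs $G$ whose number of connected subgraphs is at most $p(|G|)$; here a connected subgraph is identified with its vertex set, so that what is counted are the nonempty sets $A\subseteq V(G)$ for which $G[A]$ is connected. Then: 1. there is a polynomial-time algorithm that, given $G\in\mathcal G_p$, a colour-set $C$, a colouring $\omega:V(G)\to C$ and a colour $d\in C$, computes $m_G(G,\omega,d)$; 2. there is a polynomial-time algorithm that, given $G\in\mathcal G_p$, a colour-set $C$ and a colouring $\omega:V(G)\to C$, computes $m_G(G,\omega)$. The number of colours is unbounded: $C$ is part of the input. An algorithm is a (multi-stack) Turing machine, which may depend on $p$ and which need only be correct on inputs with $G\in\mathcal G_p$.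 Its input is the word over $\{0,1,\#\}$ that lists $|V(G)|$ and $|C|$ in unary, the adjacency matrix of $G$, the colours of the vertices and, in part 1, the colour $d$ (colours being written in unary as elements of $\{0,\dots,|C|-1\}$), so that polynomial time means polynomial in $|V(G)|+|C|$. Its output is the required number in unary. -/

import Mathlib

namespace FloodIt

variable {V C : Type*}

/-- The spanning subgraph of `G` consisting of the edges whose two ends have the same colour under
`ω`; its connected components are the monochromatic components of the coloured graph `(G, ω)`. -/
def monoGraph (G : SimpleGraph V) (ω : V → C) : SimpleGraph V where
  Adj u v := G.Adj u v ∧ ω u = ω v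
  symm := ⟨fun _ _ h => ⟨h.1.symm, h.2.symm⟩⟩
  loopless := ⟨fun _ h => G.irrefl h.1⟩

/-- The vertex set of the monochromatic component of `(G, ω)` that contains `v`. -/
def comp (G : SimpleGraph V) (ω : V → C) (v : V) : Set V :=
  {u | (monoGraph G ω).Reachable v u}

open Classical in
/-- The colouring obtained from `ω` by the move `m = (v, d)`: all vertices in the monochromatic
component of `v` get colour `d`, the others keep their colour. -/
noncomputable def play (G : SimpleGraph V) (ω : V → C) (m : V × C) : V → C :=
  fun u => if u ∈ comp G ω m.1 then m.2 else ω u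

/-- The colouring obtained from `ω` by playing the moves of the list `S` in order. -/
noncomputable def playSeq (G : SimpleGraph V) (ω : V → C) (S : List (V × C)) : V → C :=
  S.foldl (play G) ω

/-- `m_G(G, ω, d)`: the minimum number of moves that give all vertices of `G` colour `d`. -/
noncomputable def floodNumber (G : SimpleGraph V) (ω : V → C) (d : C) : ℕ :=
  sInf {k | ∃ S : List (V × C), S.length = k ∧ ∀ v, playSeq G ω S v = d}

/-- `m_G(G, ω)`: the minimum of `m_G(G, ω, d)` over all colours `d` of the colour-set `C`. -/
noncomputable def minFloodNumber (G : SimpleGraph V) (ω : V → C) : ℕ :=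
  ⨅ d : C, floodNumber G ω d

theorem playSeq_eq_of_mem (G : SimpleGraph V) (d : C) (l : List V) (ω : V → C) (v : V)
    (h : v ∈ l ∨ ω v = d) : playSeq G ω (l.map fun u => (u, d)) v = d := by
  induction l generalizing ω with
  | nil => simpa [playSeq] using h
  | cons a l ih =>
    refine ih (play G ω (a, d)) ?_
    by_cases hl : v ∈ l
    · exact Or.inl hl
    right
    by_cases hv : v ∈ comp G ω a
    · simp [play, hv]
    · rcases h with h | h
      · rcases List.mem_cons.1 h with rfl | h
        · exact absurd (SimpleGraph.Reachable.refl _) hv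
        · exact absurd h hl
      · simp [play, hv, h]

/-- On a finite graph the minimum in the definition of `m_G(G, ω, d)` is taken over a nonempty
set. -/
theorem floodNumber_set_nonempty [Finite V] (G : SimpleGraph V) (ω : V → C) (d : C) :
    {k | ∃ S : List (V × C), S.length = k ∧ ∀ v, playSeq G ω S v = d}.Nonempty := by
  have := Fintype.ofFinite V
  exact ⟨_, Finset.univ.toList.map (fun u => (u, d)), rfl,
    fun v => playSeq_eq_of_mem G d _ ω v (Or.inl (by simp))⟩

/-- The number of connected subgraphs of `G`, a connected subgraph being identified with its vertex
set: the number of nonempty `A ⊆ V(G)` such that `G[A]` is connected. -/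
noncomputable def numConnectedSubgraphs (G : SimpleGraph V) : ℕ :=
  Set.ncard {A : Set V | (G.induce A).Connected}

/-- A coloured graph as the input of an algorithm: a graph `G` with vertices `0, …, n - 1` and a
colouring `ω` (not necessarily proper) from the nonempty colour-set `{0, …, c - 1}`. The number `c`
of colours is part of the input. -/
structure ColouredGraph where
  n : ℕ
  c : ℕ
  c_pos : 0 < c
  G : SimpleGraph (Fin n)
  ω : Fin n → Fin c

/-- A coloured graph together with a colour `d` of its colour-set. -/
structure TargetedColouredGraph extends ColouredGraph where
  d : Fin c

/-- The class `𝒢_p` (as a condition on coloured graphs): the number of connected subgraphs of `G`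
is at most `p(|G|)`. -/
def ColouredGraph.InClass (I : ColouredGraph) (p : Polynomial ℝ) : Prop :=
  (numConnectedSubgraphs I.G : ℝ) ≤ p.eval (I.n : ℝ)

/-- A number as a word `1…1#` over the alphabet `{0, 1, #}`, with `#` written as `none`. -/
def unaryWord (k : ℕ) : List (Option Bool) :=
  List.replicate k (some true) ++ [none]

open Classical in
/-- A coloured graph as a word over `{0, 1, #}`: the number of vertices, the number of colours,
the rows of the adjacency matrix (each followed by `#`), and the colours of the vertices. -/
noncomputable def ColouredGraph.encode (I : ColouredGraph) : List (Option Bool) :=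
  unaryWord I.n ++ unaryWord I.c ++
    (List.finRange I.n).flatMap (fun u =>
      (List.finRange I.n).map (fun v => some (decide (I.G.Adj u v))) ++ [none]) ++
    (List.finRange I.n).flatMap (fun v => unaryWord (I.ω v))

/-- The word for a coloured graph, followed by the target colour. -/
noncomputable def TargetedColouredGraph.encode (I : TargetedColouredGraph) : List (Option Bool) :=
  I.toColouredGraph.encode ++ unaryWord I.d

end FloodIt

/-! Consider statements "the vertex set `A` can be given colour `d` at cost `k`", derived by three
rules: a single vertex has its own colour at cost 0; a derived set may be recoloured at cost 1; two
derived sets of the same colour joined by an edge may be united, the costs being added. The claim is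
that `floodNumber G ω d` is the sum, over the connected components of `G`, of the least cost of
deriving that component with colour `d`.

Completeness (`DerD.comp_playSeq`): after any sequence of moves, each monochromatic component has
been assembled from disjoint older components, and its derivation costs exactly the number of moves
played at its vertices. Soundness (`Der.exists_playSeq`): a derivation can be turned into that many
moves. If its leaves are whole monochromatic components and only disjoint sets are united, a
recolouring applied directly to a leaf can be played first (`DDer.exists_move`), and the rest
remains a derivation for the new colouring. Overlapping unions are reduced to disjoint ones at no
cost by `CDer.merge`. The algorithm may thus ignore disjointness, although completeness produces
only disjoint unions.

The algorithm closes the facts `(A, d, k)` with `k ≤ n` under the rules. All sets that occur are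
connected, so there are at most (number of connected subgraphs) · `c` · `(n + 1)` facts. A disjoint
derivation has depth less than `|A| + k ≤ 2n`, so `2n` rounds suffice. On `𝒢_p` everything is
polynomial.

For the Turing machines, a small structured language on four stacks is compiled to `TM2` code
(`Exec.reachIn`). On top of it, functions between tree-encoded types that are computable in
polynomial time (`PT`) are closed under composition, list operations, arithmetic and folds with
polynomially bounded accumulators, and the algorithm is written with these operations. -/

namespace FloodIt

/-! ### From derivations to sequences of moves. -/

section Sound

variable {V C : Type*} {G : SimpleGraph V} {ω ω' : V → C}

theorem mem_comp_self (v : V) : v ∈ comp G ω v := SimpleGraph.Reachable.refl _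

theorem colour_eq_of_mem_comp {u v : V} (h : u ∈ comp G ω v) : ω u = ω v := by
  obtain ⟨p⟩ := h
  induction p with
  | nil => rfl
  | cons h _ ih => exact ih.trans h.2.symm

theorem comp_eq_of_mem {u v : V} (h : u ∈ comp G ω v) : comp G ω u = comp G ω v := by
  ext x
  exact ⟨fun hx => SimpleGraph.Reachable.trans h hx, fun hx => (SimpleGraph.Reachable.symm h).trans hx⟩

theorem mem_comp_of_adj {u v x : V} (h : u ∈ comp G ω v) (ha : G.Adj u x) (hc : ω u = ω x) :
    x ∈ comp G ω v :=
  SimpleGraph.Reachable.trans h (SimpleGraph.Adj.reachable (G := monoGraph G ω) ⟨ha, hc⟩)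

theorem play_of_mem {v x : V} {d : C} (h : x ∈ comp G ω v) : play G ω (v, d) x = d := by
  simp [play, h]

theorem play_of_notMem {v x : V} {d : C} (h : x ∉ comp G ω v) : play G ω (v, d) x = ω x := by
  simp [play, h]

theorem comp_mono_of_imp (h : ∀ u v, G.Adj u v → ω u = ω v → ω' u = ω' v) (v : V) :
    comp G ω v ⊆ comp G ω' v := fun _ hx =>
  SimpleGraph.Reachable.mono (G := monoGraph G ω) (G' := monoGraph G ω')
    (fun a b (hab : (monoGraph G ω).Adj a b) => ⟨hab.1, h a b hab.1 hab.2⟩) hx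

/-- A component is either recoloured as a whole or left alone, so a move never splits one. -/
theorem comp_subset_comp_play (m : V × C) (v : V) : comp G ω v ⊆ comp G (play G ω m) v := by
  refine comp_mono_of_imp (fun a b hab hc => ?_) v
  by_cases ha : a ∈ comp G ω m.1
  · simp [play, ha, mem_comp_of_adj ha hab hc]
  · have hb : b ∉ comp G ω m.1 := fun hb => ha (mem_comp_of_adj hb hab.symm hc.symm)
    simp [play, ha, hb, hc]

/-- Two vertex sets are linked if they meet or are joined by an edge. -/
def Linked (G : SimpleGraph V) (A B : Set V) : Prop :=
  ∃ a ∈ A, ∃ b ∈ B, a = b ∨ G.Adj a b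

theorem Linked.mono {A A' B B' : Set V} (h : Linked G A B) (hA : A ⊆ A') (hB : B ⊆ B') :
    Linked G A' B' := by
  obtain ⟨a, ha, b, hb, hab⟩ := h
  exact ⟨a, hA ha, b, hB hb, hab⟩

theorem Linked.symm {A B : Set V} (h : Linked G A B) : Linked G B A := by
  obtain ⟨a, ha, b, hb, hab⟩ := h
  exact ⟨b, hb, a, ha, hab.imp Eq.symm SimpleGraph.Adj.symm⟩

/-- `Der G ω A d k`: a formal derivation that the set `A` can be given colour `d` at cost `k`;
monochromatic sets are free, recolouring costs one, and linked sets of one colour can be united. -/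
inductive Der (G : SimpleGraph V) (ω : V → C) : Set V → C → ℕ → Prop
  | leaf (v : V) (A : Set V) : v ∈ A → A ⊆ comp G ω v → Der G ω A (ω v) 0
  | recolour {A d k} (d' : C) : Der G ω A d k → Der G ω A d' (k + 1)
  | join {A B d k l} : Der G ω A d k → Der G ω B d l → Linked G A B → Der G ω (A ∪ B) d (k + l)

/-- Derivations whose leaves are whole monochromatic components; the last index is the number of
leaves. -/
inductive CDer (G : SimpleGraph V) (ω : V → C) : Set V → C → ℕ → ℕ → Prop
  | leaf (v : V) : CDer G ω (comp G ω v) (ω v) 0 1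
  | recolour {A d k n} (d' : C) : CDer G ω A d k n → CDer G ω A d' (k + 1) n
  | join {A B d k l n m} : CDer G ω A d k n → CDer G ω B d l m → Linked G A B →
      CDer G ω (A ∪ B) d (k + l) (n + m)

/-- Derivations in which one leaf, the monochromatic component of `x`, is distinguished; the last
index is the number of the other leaves. -/
inductive Ctx (G : SimpleGraph V) (ω : V → C) (x : V) : Set V → C → ℕ → ℕ → Prop
  | hole : Ctx G ω x (comp G ω x) (ω x) 0 0
  | recolour {A d k n} (d' : C) : Ctx G ω x A d k n → Ctx G ω x A d' (k + 1) n
  | join {A B d k l n m} : Ctx G ω x A d k n → CDer G ω B d l m → Linked G A B →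
      Ctx G ω x (A ∪ B) d (k + l) (n + m)

/-- Derivations from whole monochromatic components in which only disjoint sets are united. -/
inductive DDer (G : SimpleGraph V) (ω : V → C) : Set V → C → ℕ → Prop
  | leaf (v : V) : DDer G ω (comp G ω v) (ω v) 0
  | recolour {A d k} (d' : C) : DDer G ω A d k → DDer G ω A d' (k + 1)
  | join {A B d k l} : DDer G ω A d k → DDer G ω B d l → Linked G A B → Disjoint A B →
      DDer G ω (A ∪ B) d (k + l)

/-- Enlarging every leaf to its whole component costs nothing and preserves links. The closed set
`K` confines the enlarged sets, so that the connected components of `G` can later be handled one by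
one. -/
theorem Der.exists_cder {A : Set V} {d : C} {k : ℕ} (h : Der G ω A d k) {K : Set V}
    (hK : ∀ a ∈ K, ∀ b, G.Adj a b → b ∈ K) (hA : A ⊆ K) :
    ∃ A' n, A ⊆ A' ∧ A' ⊆ K ∧ CDer G ω A' d k n := by
  induction h with
  | leaf v A hv hA' =>
    refine ⟨_, _, hA', fun x hx => ?_, CDer.leaf v⟩
    obtain ⟨p⟩ := hx
    have hvK := hA hv
    clear hv hA'
    induction p with
    | nil => exact hvK
    | cons h _ ih => exact ih (hK _ hvK _ h.1)
  | recolour d' _ ih =>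
    obtain ⟨A', n, h1, h2, h3⟩ := ih hA
    exact ⟨A', n, h1, h2, h3.recolour d'⟩
  | join _ _ hl ih1 ih2 =>
    obtain ⟨A', n, h1, h2, h3⟩ := ih1 (Set.subset_union_left.trans hA)
    obtain ⟨B', m, h4, h5, h6⟩ := ih2 (Set.subset_union_right.trans hA)
    exact ⟨_, _, Set.union_subset_union h1 h4, Set.union_subset h2 h5, h3.join h6 (hl.mono h1 h4)⟩

theorem CDer.exists_ctx {A : Set V} {d : C} {k n : ℕ} (h : CDer G ω A d k n) {x : V}
    (hx : x ∈ A) : ∃ m, n = m + 1 ∧ Ctx G ω x A d k m := by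
  induction h with
  | leaf v =>
    refine ⟨0, rfl, ?_⟩
    rw [← comp_eq_of_mem hx, ← colour_eq_of_mem_comp hx]
    exact Ctx.hole
  | recolour d' _ ih =>
    obtain ⟨m, hm, h⟩ := ih hx
    exact ⟨m, hm, h.recolour d'⟩
  | @join A B d k l n m h1 h2 hl ih1 ih2 =>
    by_cases hA : x ∈ A
    · obtain ⟨p, rfl, h⟩ := ih1 hA
      exact ⟨p + m, by omega, h.join h2 hl⟩
    · obtain ⟨p, rfl, h⟩ := ih2 (hx.resolve_left hA)
      refine ⟨p + n, by omega, ?_⟩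
      rw [Set.union_comm, add_comm k]
      exact h.join h1 hl.symm

theorem Ctx.subset {x : V} {A : Set V} {d : C} {k n : ℕ} (h : Ctx G ω x A d k n) :
    comp G ω x ⊆ A := by
  induction h with
  | hole => exact subset_rfl
  | recolour _ _ ih => exact ih
  | join _ _ _ ih => exact ih.trans Set.subset_union_left

/-- The steps above the hole see only the colour of what fills it, and links survive enlargement. -/
theorem Ctx.fill {x : V} {A : Set V} {d : C} {k n : ℕ} (h : Ctx G ω x A d k n) {Z : Set V}
    {z m : ℕ} (hZ : CDer G ω Z (ω x) z m) (hx : comp G ω x ⊆ Z) :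
    CDer G ω (A ∪ Z) d (k + z) (n + m) := by
  induction h with
  | hole => rw [Set.union_eq_self_of_subset_left hx]; simpa using hZ
  | recolour d' _ ih => rw [Nat.add_right_comm]; exact ih.recolour d'
  | join _ hB hl ih =>
    have := ih.join hB (hl.mono Set.subset_union_left subset_rfl)
    rwa [Set.union_right_comm, Nat.add_right_comm, Nat.add_right_comm _ m] at this

theorem Ctx.toCDer {x : V} {A : Set V} {d : C} {k n : ℕ} (h : Ctx G ω x A d k n) :
    CDer G ω A d k (n + 1) := by
  simpa [Set.union_eq_self_of_subset_right h.subset] using h.fill (CDer.leaf x) subset_rfl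

/-- `Z` is what has been assembled around `x` before the first recolouring on the way from the hole
to the root. That recolouring forgets the colour below it, so there `Z` may be replaced by a larger
set of any colour. The first alternative is that no recolouring occurs on that way. -/
theorem Ctx.split {x : V} {A : Set V} {d : C} {k n : ℕ} (h : Ctx G ω x A d k n) :
    ∃ Z z m k' n', k = z + k' ∧ n = m + n' ∧ Z ⊆ A ∧ Ctx G ω x Z (ω x) z m ∧
      ((A = Z ∧ d = ω x ∧ k' = 0 ∧ n' = 0) ∨
        ∀ Y e y p, CDer G ω Y e y p → Z ⊆ Y → CDer G ω (A ∪ Y) d (k' + y) (n' + p)) := by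
  induction h with
  | hole => exact ⟨_, 0, 0, 0, 0, rfl, rfl, subset_rfl, Ctx.hole, Or.inl ⟨rfl, rfl, rfl, rfl⟩⟩
  | recolour d' _ ih =>
    obtain ⟨Z, z, m, k', n', rfl, rfl, hZ, hc, h | h⟩ := ih
    · obtain ⟨rfl, rfl, rfl, rfl⟩ := h
      refine ⟨_, z, m, 1, 0, rfl, rfl, hZ, hc, Or.inr fun Y e y p hY hs => ?_⟩
      rw [Set.union_eq_self_of_subset_left hs, add_comm 1, zero_add]
      exact hY.recolour d'
    · refine ⟨Z, z, m, k' + 1, n', rfl, rfl, hZ, hc, Or.inr fun Y e y p hY hs => ?_⟩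
      rw [Nat.add_right_comm]
      exact (h Y e y p hY hs).recolour d'
  | @join A B d k l n q _ hB hl ih =>
    obtain ⟨Z, z, m, k', n', rfl, rfl, hZ, hc, h | h⟩ := ih
    · obtain ⟨rfl, rfl, rfl, rfl⟩ := h
      exact ⟨_, _, _, 0, 0, rfl, rfl, subset_rfl, hc.join hB hl, Or.inl ⟨rfl, rfl, rfl, rfl⟩⟩
    · refine ⟨Z, z, m, k' + l, n' + q, by omega, by omega, hZ.trans Set.subset_union_left, hc,
        Or.inr fun Y e y p hY hs => ?_⟩
      have := (h Y e y p hY hs).join hB (hl.mono Set.subset_union_left subset_rfl)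
      rwa [Set.union_right_comm, Nat.add_right_comm, Nat.add_right_comm n'] at this

/-- Both derivations contain the leaf `comp G ω x`. In the one for `A` this leaf is replaced by the
part `Z` of the other one that precedes its first recolouring, and the result, of colour `d`, is
inserted into the derivation for `B` in place of `Z`. The costs add up as before, but the common
leaf is now used only once. -/
theorem CDer.merge {A B : Set V} {d : C} {k l n m : ℕ} (hA : CDer G ω A d k n)
    (hB : CDer G ω B d l m) {x : V} (hxA : x ∈ A) (hxB : x ∈ B) :
    ∃ p < n + m, CDer G ω (A ∪ B) d (k + l) p := by
  obtain ⟨n, rfl, cA⟩ := hA.exists_ctx hxA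
  obtain ⟨m, rfl, cB⟩ := hB.exists_ctx hxB
  obtain ⟨Z, z, q, k', n', rfl, rfl, hZ, hc, h⟩ := cB.split
  have hf := cA.fill hc.toCDer hc.subset
  rcases h with ⟨rfl, rfl, rfl, rfl⟩ | h
  · exact ⟨_, by omega, hf⟩
  · refine ⟨n' + (n + (q + 1)), by omega, ?_⟩
    have := h _ _ _ _ hf Set.subset_union_right
    rw [show B ∪ (A ∪ Z) = A ∪ B by
      rw [Set.union_left_comm, Set.union_eq_self_of_subset_right hZ]] at this
    convert this using 1
    omega

/-- Outer induction on the number of leaves: an overlapping union is exchanged for the derivation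
from `CDer.merge`, which has fewer leaves. -/
theorem CDer.toDDer {A : Set V} {d : C} {k n : ℕ} (h : CDer G ω A d k n) : DDer G ω A d k := by
  suffices H : ∀ N, ∀ A d k n, CDer G ω A d k n → n ≤ N → DDer G ω A d k from H n A d k n h le_rfl
  intro N
  induction N with
  | zero =>
    intro A d k n h hn
    exfalso
    induction h with
    | leaf => omega
    | recolour _ _ ih => exact ih hn
    | join _ _ _ ih => exact ih (by omega)
  | succ N ihN =>
    intro A d k n h hn
    induction h with
    | leaf v => exact DDer.leaf v
    | recolour d' _ ih => exact (ih hn).recolour d'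
    | @join A B d k l n m hA hB hl ihA ihB =>
      by_cases hd : Disjoint A B
      · exact (ihA (by omega)).join (ihB (by omega)) hl hd
      · obtain ⟨x, hxA, hxB⟩ := Set.not_disjoint_iff.1 hd
        obtain ⟨p, hp, h⟩ := hA.merge hB hxA hxB
        exact ihN _ _ _ _ h (by omega)

theorem DDer.comp_subset {A : Set V} {d : C} {k : ℕ} (h : DDer G ω A d k) {x : V} (hx : x ∈ A) :
    comp G ω x ⊆ A := by
  induction h with
  | leaf v => rw [comp_eq_of_mem hx]
  | recolour _ _ ih => exact ih hx
  | join _ _ _ _ ih1 ih2 =>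
    rcases hx with hx | hx
    · exact (ih1 hx).trans Set.subset_union_left
    · exact (ih2 hx).trans Set.subset_union_right

/-- The leaves keep their colours, but their components may have grown into the recoloured one.
Hence the conclusion is only `Der`, whose leaves may be parts of components. -/
theorem DDer.der_play {A : Set V} {d : C} {k : ℕ} (h : DDer G ω A d k) {x : V} {b : C}
    (hx : Disjoint A (comp G ω x)) : Der G (play G ω (x, b)) A d k := by
  induction h with
  | leaf v =>
    rw [← play_of_notMem (d := b) (Set.disjoint_left.1 hx (mem_comp_self v))]
    exact Der.leaf v _ (mem_comp_self v) (comp_subset_comp_play _ _)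
  | recolour d' _ ih => exact (ih hx).recolour d'
  | join _ _ hl _ ih1 ih2 =>
    exact (ih1 (hx.mono_left Set.subset_union_left)).join
      (ih2 (hx.mono_left Set.subset_union_right)) hl

/-- The move is a recolouring applied directly to a leaf. At a join, the played component lies
inside one side by `DDer.comp_subset`, so disjointness protects the other side. Two leaves cannot be
joined: linked components of one colour coincide and are not disjoint. A derivation without such a
move is therefore a single leaf. -/
theorem DDer.exists_move {A : Set V} {d : C} {k : ℕ} (h : DDer G ω A d k) :
    (k = 0 ∧ ∃ a, A = comp G ω a ∧ d = ω a) ∨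
      ∃ x ∈ A, ∃ b k', k = k' + 1 ∧ Der G (play G ω (x, b)) A d k' := by
  induction h with
  | leaf v => exact Or.inl ⟨rfl, v, rfl, rfl⟩
  | recolour d' _ ih =>
    right
    rcases ih with ⟨rfl, a, rfl, rfl⟩ | ⟨x, hx, b, k', rfl, h⟩
    · refine ⟨a, mem_comp_self a, d', 0, rfl, ?_⟩
      have := Der.leaf (G := G) (ω := play G ω (a, d')) a _ (mem_comp_self a)
        (comp_subset_comp_play (a, d') a)
      rwa [play_of_mem (mem_comp_self a)] at this
    · exact ⟨x, hx, b, k' + 1, rfl, h.recolour d'⟩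
  | @join A B d k l hA hB hl hd ihA ihB =>
    right
    rcases ihA with ⟨rfl, a, rfl, rfl⟩ | ⟨x, hx, b, k', rfl, h⟩
    · rcases ihB with ⟨rfl, a', rfl, ha'⟩ | ⟨x, hx, b, k', rfl, h⟩
      · exfalso
        obtain ⟨u, hu, v, hv, huv⟩ := hl
        rcases huv with rfl | huv
        · exact Set.disjoint_left.1 hd hu hv
        · refine Set.disjoint_left.1 hd (mem_comp_of_adj hu huv ?_) hv
          rw [colour_eq_of_mem_comp hu, colour_eq_of_mem_comp hv, ha']
      · refine ⟨x, Or.inr hx, b, k', by omega, ?_⟩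
        rw [← zero_add k']
        exact (hA.der_play (hd.mono_right (hB.comp_subset hx))).join h hl
    · refine ⟨x, Or.inl hx, b, k' + l, by omega, ?_⟩
      exact h.join (hB.der_play (hd.symm.mono_right (hA.comp_subset hx))) hl

theorem playSeq_append (S T : List (V × C)) :
    playSeq G ω (S ++ T) = playSeq G (playSeq G ω S) T := by
  simp [playSeq]

/-- A derivation of cost `k` gives a sequence of `k` moves. -/
theorem Der.exists_playSeq {A K : Set V} {d : C} {k : ℕ} (h : Der G ω A d k)
    (hK : ∀ a ∈ K, ∀ b, G.Adj a b → b ∈ K) (hA : A ⊆ K) :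
    ∃ S : List (V × C), S.length = k ∧ (∀ m ∈ S, m.1 ∈ K) ∧ ∀ a ∈ A, playSeq G ω S a = d := by
  -- Each round normalises the derivation, plays one move and continues from the new colouring with
  -- cost one less.
  induction k generalizing ω A with
  | zero =>
    obtain ⟨A', n, h1, h2, h3⟩ := h.exists_cder hK hA
    rcases h3.toDDer.exists_move with ⟨-, a, rfl, rfl⟩ | ⟨x, hx, b, k', hk', -⟩
    · exact ⟨[], rfl, by simp, fun x hx => colour_eq_of_mem_comp (h1 hx)⟩
    · omega
  | succ k ih =>
    obtain ⟨A', n, h1, h2, h3⟩ := h.exists_cder hK hA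
    rcases h3.toDDer.exists_move with ⟨hk, -⟩ | ⟨x, hx, b, k', hk', h⟩
    · omega
    · obtain rfl : k = k' := by omega
      obtain ⟨S, hS, hSK, hSA⟩ := ih h h2
      exact ⟨(x, b) :: S, by simp [hS], by simpa using ⟨h2 hx, by simpa using hSK⟩,
        fun a ha => hSA a (h1 ha)⟩

theorem comp_subset_of_closed {K : Set V} (hK : ∀ a ∈ K, ∀ b, G.Adj a b → b ∈ K) {v : V}
    (hv : v ∈ K) : comp G ω v ⊆ K := by
  rintro x ⟨p⟩
  induction p with
  | nil => exact hv
  | cons h _ ih => exact ih (hK _ hv _ h.1)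

theorem playSeq_of_notMem {K : Set V} (hK : ∀ a ∈ K, ∀ b, G.Adj a b → b ∈ K)
    {S : List (V × C)} (hS : ∀ m ∈ S, m.1 ∈ K) {x : V} (hx : x ∉ K) : playSeq G ω S x = ω x := by
  induction S generalizing ω with
  | nil => rfl
  | cons m S ih =>
    refine (ih fun m' hm' => hS m' (by simp [hm'])).trans ?_
    exact play_of_notMem fun h => hx (comp_subset_of_closed hK (hS m (by simp)) h)

theorem comp_congr {K : Set V} (hK : ∀ a ∈ K, ∀ b, G.Adj a b → b ∈ K) (h : ∀ a ∈ K, ω a = ω' a)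
    {v : V} (hv : v ∈ K) : comp G ω v = comp G ω' v := by
  have key : ∀ {ω ω' : V → C}, (∀ a ∈ K, ω a = ω' a) → comp G ω v ⊆ comp G ω' v := by
    rintro ω ω' h x ⟨p⟩
    suffices H : ∀ u, u ∈ K → (monoGraph G ω).Walk u x → (monoGraph G ω').Reachable u x from H v hv p
    intro u hu p
    induction p with
    | nil => exact SimpleGraph.Reachable.refl _
    | cons hh p ih =>
      have hb := hK _ hu _ hh.1
      refine SimpleGraph.Reachable.trans (SimpleGraph.Adj.reachable ?_) (ih p hb)
      exact ⟨hh.1, by rw [← h _ hu, ← h _ hb]; exact hh.2⟩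
  exact (key h).antisymm (key fun a ha => (h a ha).symm)

theorem playSeq_congr {K : Set V} (hK : ∀ a ∈ K, ∀ b, G.Adj a b → b ∈ K)
    {S : List (V × C)} (hS : ∀ m ∈ S, m.1 ∈ K) (h : ∀ a ∈ K, ω a = ω' a) :
    ∀ a ∈ K, playSeq G ω S a = playSeq G ω' S a := by
  induction S generalizing ω ω' with
  | nil => exact h
  | cons m S ih =>
    refine ih (fun m' hm' => hS m' (by simp [hm'])) fun a ha => ?_
    rw [play, play, comp_congr hK h (hS m (by simp)), h a ha]

/-- Derivations for the connected components of `G` can be played one after the other. -/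
theorem exists_playSeq_of_components {d : C} (s : Finset G.ConnectedComponent)
    (κ : G.ConnectedComponent → ℕ) (h : ∀ K ∈ s, Der G ω K.supp d (κ K)) :
    ∃ S : List (V × C), S.length = ∑ K ∈ s, κ K ∧
      (∀ m ∈ S, G.connectedComponentMk m.1 ∈ s) ∧
      ∀ v, G.connectedComponentMk v ∈ s → playSeq G ω S v = d := by
  classical
  induction s using Finset.induction_on with
  | empty => exact ⟨[], rfl, by simp, by simp⟩
  | insert K s hK ih =>
    obtain ⟨S, h1, h2, h3⟩ := ih fun K' hK' => h K' (Finset.mem_insert_of_mem hK')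
    have clK : ∀ a ∈ K.supp, ∀ b, G.Adj a b → b ∈ K.supp := fun a ha b hab =>
      (SimpleGraph.ConnectedComponent.connectedComponentMk_eq_of_adj hab).symm.trans ha
    have cls : ∀ a ∈ {v | G.connectedComponentMk v ∈ s}, ∀ b, G.Adj a b →
        b ∈ {v | G.connectedComponentMk v ∈ s} := fun a ha b hab => by
      have := SimpleGraph.ConnectedComponent.connectedComponentMk_eq_of_adj hab
      simpa [← this] using ha
    obtain ⟨T, t1, t2, t3⟩ := (h K (Finset.mem_insert_self _ _)).exists_playSeq clK subset_rfl
    refine ⟨S ++ T, ?_, ?_, ?_⟩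
    · rw [List.length_append, h1, t1, Finset.sum_insert hK, add_comm]
    · intro m hm
      rcases List.mem_append.1 hm with hm | hm
      · exact Finset.mem_insert_of_mem (h2 m hm)
      · rw [show G.connectedComponentMk m.1 = K from t2 m hm]
        exact Finset.mem_insert_self _ _
    · intro v hv
      rw [playSeq_append]
      rcases Finset.mem_insert.1 hv with hv | hv
      · rw [← t3 v hv]
        refine playSeq_congr clK t2 (fun a ha => playSeq_of_notMem cls h2 fun ha' => hK ?_) v hv
        rwa [← show G.connectedComponentMk a = K from ha]
      · rw [playSeq_of_notMem clK t2 (fun hv' => hK ?_), h3 v hv]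
        rwa [← show G.connectedComponentMk v = K from hv']

end Sound

/-! ### From sequences of moves to derivations. -/

section Complete

variable {V C : Type*} {G : SimpleGraph V} {ω : V → C}

/-- Derivations from single vertices in which only disjoint sets are united. -/
inductive DerD (G : SimpleGraph V) (ω : V → C) : Set V → C → ℕ → Prop
  | single (v : V) : DerD G ω {v} (ω v) 0
  | recolour {A d k} (d' : C) : DerD G ω A d k → DerD G ω A d' (k + 1)
  | join {A B d k l} : DerD G ω A d k → DerD G ω B d l → Disjoint A B →
      (∃ a ∈ A, ∃ b ∈ B, G.Adj a b) → DerD G ω (A ∪ B) d (k + l)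

variable [Finite V]

/-- Take a maximal derivable union of blocks containing `x` inside the component. If it were not
everything, some edge of the component would leave it, and the block at the far end, disjoint from
it, could be joined. Disjointness makes the costs `∑ w` additive. -/
theorem DerD.comp_of_blocks {θ : V → C} {w : V → ℕ} (block : V → Set V) (hself : ∀ x, x ∈ block x)
    (hblock : ∀ x, ∀ u ∈ block x, block u = block x) (hθ : ∀ x, block x ⊆ comp G θ x)
    (h : ∀ x, DerD G ω (block x) (θ x) (∑ᶠ u ∈ block x, w u)) (x : V) :
    DerD G ω (comp G θ x) (θ x) (∑ᶠ u ∈ comp G θ x, w u) := by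
  obtain ⟨Z, hZ⟩ := (Set.toFinite {Z : Set V | x ∈ Z ∧ Z ⊆ comp G θ x ∧ (∀ z ∈ Z, block z ⊆ Z) ∧
    DerD G ω Z (θ x) (∑ᶠ u ∈ Z, w u)}).exists_maximal
    ⟨block x, hself x, hθ x, fun z hz => (hblock x z hz).subset, h x⟩
  obtain ⟨hxZ, hZs, hZb, hZd⟩ := hZ.prop
  suffices hZe : Z = comp G θ x by rwa [← hZe]
  refine hZs.antisymm fun y hy => ?_
  by_contra hyZ
  obtain ⟨p⟩ := hy
  obtain ⟨⟨⟨a, b⟩, hab⟩, -, ha, hb⟩ := p.exists_boundary_dart Z hxZ hyZ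
  replace hab : G.Adj a b ∧ θ a = θ b := hab
  simp only at ha hb
  have hbx : b ∈ comp G θ x := mem_comp_of_adj (hZs ha) hab.1 hab.2
  have hd : Disjoint Z (block b) := Set.disjoint_left.2 fun u hu hub => by
    have := hZb u hu
    rw [hblock b u hub] at this
    exact hb (this (hself b))
  refine hb (hZ.le_of_ge (y := Z ∪ block b) ⟨Or.inl hxZ, ?_, ?_, ?_⟩ Set.subset_union_left
    (Or.inr (hself b)))
  · refine Set.union_subset hZs ?_
    rw [← comp_eq_of_mem hbx]
    exact hθ b
  · rintro z (hz | hz)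
    · exact (hZb z hz).trans Set.subset_union_left
    · rw [hblock b z hz]
      exact Set.subset_union_right
  · rw [finsum_mem_union hd (Set.toFinite _) (Set.toFinite _)]
    have hb' := h b
    rw [colour_eq_of_mem_comp hbx] at hb'
    exact hZd.join hb' hd ⟨a, ha, b, hself b, hab.1⟩

open Classical in
/-- After any sequence of moves, every monochromatic component is derivable at a cost equal to the
number of moves played at its vertices. -/
theorem DerD.comp_playSeq (S : List (V × C)) (x : V) :
    DerD G ω (comp G (playSeq G ω S) x) (playSeq G ω S x)
      (∑ᶠ u ∈ comp G (playSeq G ω S) x, (S.map Prod.fst).count u) := by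
  induction S using List.reverseRecOn generalizing x with
  | nil =>
    refine DerD.comp_of_blocks (fun x => {x}) (fun x => rfl) (fun x u hu => by rw [hu]) ?_ ?_ x
    · rintro x u rfl
      exact mem_comp_self _
    · intro x
      simpa [playSeq] using DerD.single x
  | append_singleton S m ih =>
    obtain ⟨v, d⟩ := m
    rw [playSeq_append]
    set ω' := playSeq G ω S
    change DerD G ω (comp G (play G ω' (v, d)) x) (play G ω' (v, d) x) _
    -- The blocks are the components before the last move. Only the block of `v` changes: it pays
    -- one recolouring, and its count goes up by one.
    refine DerD.comp_of_blocks (comp G ω') mem_comp_self (fun x u hu => comp_eq_of_mem hu)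
      (comp_subset_comp_play _) (fun y => ?_) x
    have hs : ∀ A : Set V, ∑ᶠ u ∈ A, ((S ++ [(v, d)]).map Prod.fst).count u =
        ∑ᶠ u ∈ A, (S.map Prod.fst).count u + if v ∈ A then 1 else 0 := by
      intro A
      simp only [List.map_append, List.count_append]
      rw [finsum_mem_add_distrib (Set.toFinite _)]
      congr 1
      rw [finsum_mem_def, finsum_eq_single _ v]
      · simp [Set.indicator_apply]
      · intro u hu
        simp [Set.indicator_apply, hu.symm]
    rw [hs]
    by_cases hv : v ∈ comp G ω' y
    · rw [if_pos hv, play_of_mem (by rw [comp_eq_of_mem hv]; exact mem_comp_self y)]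
      exact (ih y).recolour d
    · rw [if_neg hv, play_of_notMem fun hy => hv (by rw [comp_eq_of_mem hy]; exact mem_comp_self v)]
      exact ih y

open Classical in
/-- If a sequence of moves gives all vertices colour `d`, then every connected component of `G` can
be derived, at a total cost equal to the number of moves. -/
theorem exists_derD_of_playSeq [Fintype G.ConnectedComponent] {S : List (V × C)} {d : C}
    (hS : ∀ v, playSeq G ω S v = d) : ∃ κ : G.ConnectedComponent → ℕ,
      ∑ K, κ K = S.length ∧ ∀ K, DerD G ω K.supp d (κ K) := by
  have := Fintype.ofFinite V
  have hc : ∀ v, comp G (playSeq G ω S) v = (G.connectedComponentMk v).supp := by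
    intro v
    have : monoGraph G (playSeq G ω S) = G := by
      ext a b
      simp [monoGraph, hS]
    ext u
    simp only [comp, this, Set.mem_ofPred_eq, SimpleGraph.ConnectedComponent.mem_supp_iff,
      SimpleGraph.ConnectedComponent.eq]
    exact SimpleGraph.reachable_comm
  refine ⟨fun K => ∑ᶠ u ∈ K.supp, (S.map Prod.fst).count u, ?_, ?_⟩
  · calc ∑ K : G.ConnectedComponent, ∑ᶠ u ∈ K.supp, (S.map Prod.fst).count u
        = ∑ K : G.ConnectedComponent, ∑ u with G.connectedComponentMk u = K,
            (S.map Prod.fst).count u := by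
          refine Finset.sum_congr rfl fun K _ => ?_
          rw [finsum_mem_eq_finite_toFinset_sum _ (Set.toFinite _)]
          refine Finset.sum_congr ?_ fun _ _ => rfl
          ext u
          simp [SimpleGraph.ConnectedComponent.mem_supp_iff]
      _ = ∑ u, (S.map Prod.fst).count u :=
          Finset.sum_fiberwise _ _ _
      _ = S.length := by
          have := Multiset.sum_count_eq_card (s := Finset.univ) (m := ((S.map Prod.fst : List V) :
            Multiset V)) fun _ _ => Finset.mem_univ _
          simpa using this
  · intro K
    obtain ⟨v, rfl⟩ := K.exists_rep
    have := DerD.comp_playSeq (G := G) (ω := ω) S v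
    rw [hS v, hc v] at this
    exact this

end Complete

end FloodIt

namespace FloodIt

/-! ### A structured stack language and its compilation to `TM2` machines. -/

section Machine

/-- The four work stacks of the machines used below. -/
inductive Reg
  | m | r | t | u
  deriving DecidableEq

instance : Fintype Reg := ⟨{.m, .r, .t, .u}, fun k => by cases k <;> simp⟩

/-- The contents of the four work stacks. -/
structure Store where
  m : List Bool
  r : List Bool
  t : List Bool
  u : List Bool

def Store.get (s : Store) : Reg → List Bool
  | .m => s.m
  | .r => s.r
  | .t => s.t
  | .u => s.u

def Store.set (s : Store) (k : Reg) (l : List Bool) : Store :=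
  match k with
  | .m => { s with m := l }
  | .r => { s with r := l }
  | .t => { s with t := l }
  | .u => { s with u := l }

def Store.size (s : Store) : ℕ := s.m.length + s.r.length + s.t.length + s.u.length

/-- A structured programming language on four stacks. `branch k p q` pops a symbol from `k` and
runs `p` or `q` according to its value; `loop k p` runs `p` as long as the symbol popped from `k`
is `true`; `drain k p q` empties the stack `k`, running `p` or `q` according to each symbol. -/
inductive Cmd
  | skip
  | push (k : Reg) (a : Bool)
  | seq (p q : Cmd)
  | branch (k : Reg) (p q : Cmd)
  | loop (k : Reg) (p : Cmd)
  | drain (k : Reg) (p q : Cmd)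

/-- `Exec p s n s'`: started in `s`, the program `p` stops in `s'` after at most `n` steps. -/
inductive Exec : Cmd → Store → ℕ → Store → Prop
  | slack {p s n n' s'} : Exec p s n s' → n ≤ n' → Exec p s n' s'
  | skip (s) : Exec .skip s 1 s
  | push (k a s) : Exec (.push k a) s 1 (s.set k (a :: s.get k))
  | seq {p q s s₁ s₂ n₁ n₂} : Exec p s n₁ s₁ → Exec q s₁ n₂ s₂ → Exec (.seq p q) s (n₁ + n₂) s₂
  | branch_true {k p q s l s₁ n} : s.get k = true :: l → Exec p (s.set k l) n s₁ →
      Exec (.branch k p q) s (1 + n) s₁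
  | branch_false {k p q s l s₁ n} : s.get k = false :: l → Exec q (s.set k l) n s₁ →
      Exec (.branch k p q) s (1 + n) s₁
  | loop_true {k p s l s₁ s₂ n₁ n₂} : s.get k = true :: l → Exec p (s.set k l) n₁ s₁ →
      Exec (.loop k p) s₁ n₂ s₂ → Exec (.loop k p) s (1 + (n₁ + n₂)) s₂
  | loop_false {k p s l} : s.get k = false :: l → Exec (.loop k p) s 1 (s.set k l)
  | loop_nil {k p s} : s.get k = [] → Exec (.loop k p) s 1 s
  | drain_true {k p q s l s₁ s₂ n₁ n₂} : s.get k = true :: l → Exec p (s.set k l) n₁ s₁ →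
      Exec (.drain k p q) s₁ n₂ s₂ → Exec (.drain k p q) s (1 + (n₁ + n₂)) s₂
  | drain_false {k p q s l s₁ s₂ n₁ n₂} : s.get k = false :: l → Exec q (s.set k l) n₁ s₁ →
      Exec (.drain k p q) s₁ n₂ s₂ → Exec (.drain k p q) s (1 + (n₁ + n₂)) s₂
  | drain_nil {k p q s} : s.get k = [] → Exec (.drain k p q) s 1 s

theorem Store.size_set (s : Store) (k : Reg) (l : List Bool) :
    (s.set k l).size + (s.get k).length = s.size + l.length := by
  cases k <;> simp [Store.set, Store.get, Store.size] <;> omega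

/-- A step adds at most one symbol. Time bounds therefore bound output sizes, which is needed for
composing polynomial-time programs. -/
theorem Exec.size_le {p : Cmd} {s s' : Store} {n : ℕ} (h : Exec p s n s') :
    s'.size ≤ s.size + n := by
  induction h with
  | slack _ _ ih => omega
  | skip => omega
  | push k a s =>
    have := s.size_set k (a :: s.get k)
    simp only [List.length_cons] at this
    omega
  | seq _ _ ih1 ih2 => omega
  | @branch_true k p q s l s₁ n h _ ih =>
    have := s.size_set k l
    simp only [h, List.length_cons] at this
    omega
  | @branch_false k p q s l s₁ n h _ ih =>
    have := s.size_set k l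
    simp only [h, List.length_cons] at this
    omega
  | @loop_true k p s l s₁ s₂ n₁ n₂ h _ _ ih1 ih2 =>
    have := s.size_set k l
    simp only [h, List.length_cons] at this
    omega
  | @loop_false k p s l h =>
    have := s.size_set k l
    simp only [h, List.length_cons] at this
    omega
  | loop_nil => omega
  | @drain_true k p q s l s₁ s₂ n₁ n₂ h _ _ ih1 ih2 =>
    have := s.size_set k l
    simp only [h, List.length_cons] at this
    omega
  | @drain_false k p q s l s₁ s₂ n₁ n₂ h _ _ ih1 ih2 =>
    have := s.size_set k l
    simp only [h, List.length_cons] at this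
    omega
  | drain_nil => omega

open Turing

/-- The stack alphabets: the input stack `none` is over `{0, 1, #}`, the work stacks over bits. -/
abbrev Alph : Option Reg → Type
  | none => Option Bool
  | some _ => Bool

/-- The program points of a program. -/
def Cmd.Label : Cmd → Type
  | .skip => Unit
  | .push _ _ => Unit
  | .seq p q => p.Label ⊕ q.Label
  | .branch _ p q => Option (p.Label ⊕ q.Label)
  | .loop _ p => Option p.Label
  | .drain _ p q => Option (p.Label ⊕ q.Label)

@[reducible] def Cmd.labelFintype : (p : Cmd) → Fintype p.Label
  | .skip => inferInstanceAs (Fintype Unit)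
  | .push _ _ => inferInstanceAs (Fintype Unit)
  | .seq p q =>
    have := p.labelFintype
    have := q.labelFintype
    inferInstanceAs (Fintype (p.Label ⊕ q.Label))
  | .branch _ p q =>
    have := p.labelFintype
    have := q.labelFintype
    inferInstanceAs (Fintype (Option (p.Label ⊕ q.Label)))
  | .loop _ p =>
    have := p.labelFintype
    inferInstanceAs (Fintype (Option p.Label))
  | .drain _ p q =>
    have := p.labelFintype
    have := q.labelFintype
    inferInstanceAs (Fintype (Option (p.Label ⊕ q.Label)))

instance (p : Cmd) : Fintype p.Label := p.labelFintype

def Cmd.entry : (p : Cmd) → p.Label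
  | .skip => ()
  | .push _ _ => ()
  | .seq p _ => Sum.inl p.entry
  | .branch _ _ _ => none
  | .loop _ _ => none
  | .drain _ _ _ => none

/-- Statements of the compiled machines; their internal state is the symbol popped last. -/
abbrev TStmt (Λ : Type) : Type := TM2.Stmt Alph Λ (Option (Option Bool))

/-- One of three labels, chosen by the internal state. -/
def jump {Λ : Type} (a b e : Λ) : Option (Option Bool) → Λ
  | some (some true) => a
  | some (some false) => b
  | _ => e

/-- Pop a bit and jump to one of three labels. -/
def popGoto {Λ : Type} (k : Reg) (a b e : Λ) : TStmt Λ :=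
  .pop (some k) (fun _ o => Option.map (fun x : Bool => some x) o) (.goto (jump a b e))

/-- The machine code of a program, given the labels of its program points and its exit label. -/
def Cmd.compile {Λ : Type} : (p : Cmd) → (p.Label → Λ) → Λ → p.Label → TStmt Λ
  | .skip, _, exit, _ => .goto fun _ => exit
  | .push k a, _, exit, _ => .push (some k) (fun _ => a) (.goto fun _ => exit)
  | .seq p q, emb, exit, l => match l with
    | .inl l => p.compile (fun l => emb (.inl l)) (emb (.inr q.entry)) l
    | .inr l => q.compile (fun l => emb (.inr l)) exit l
  | .branch k p q, emb, exit, l => match l with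
    -- The jump on an empty stack is arbitrary here: `Exec` has no rule for a branch on an empty
    -- stack.
    | none => popGoto k (emb (some (.inl p.entry))) (emb (some (.inr q.entry))) exit
    | some (.inl l) => p.compile (fun l => emb (some (.inl l))) exit l
    | some (.inr l) => q.compile (fun l => emb (some (.inr l))) exit l
  | .loop k p, emb, exit, l => match l with
    | none => popGoto k (emb (some p.entry)) exit exit
    | some l => p.compile (fun l => emb (some l)) (emb none) l
  | .drain k p q, emb, exit, l => match l with
    | none => popGoto k (emb (some (.inl p.entry))) (emb (some (.inr q.entry))) exit
    | some (.inl l) => p.compile (fun l => emb (some (.inl l))) (emb none) l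
    | some (.inr l) => q.compile (fun l => emb (some (.inr l))) (emb none) l

/-- The machine stacks for given input and work stacks. -/
def stk (i : List (Option Bool)) (s : Store) : ∀ k, List (Alph k)
  | none => i
  | some k => s.get k

theorem update_stk (i : List (Option Bool)) (s : Store) (k : Reg) (l : List (Alph (some k))) :
    Function.update (stk i s) (some k) l = stk i (s.set k l) := by
  funext k'
  rcases k' with _ | k'
  · exact Function.update_of_ne (by simp) _ _
  · by_cases h : k' = k
    · subst h
      refine (Function.update_self _ _ _).trans ?_
      cases k' <;> rfl
    · refine (Function.update_of_ne (by simpa using h) _ _).trans ?_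
      cases k' <;> cases k <;> first | rfl | exact absurd rfl h

theorem Store.set_tail_of_nil {s : Store} {k : Reg} (h : s.get k = []) :
    s.set k (s.get k).tail = s := by
  rcases s with ⟨_, _, _, _⟩
  cases k <;> simp only [Store.get] at h <;> subst h <;> rfl

/-- `b` is reached from `a` in at most `n` steps. -/
def ReachIn {σ : Type} (f : σ → Option σ) (n : ℕ) (a b : σ) : Prop :=
  ∃ j ≤ n, (flip bind f)^[j] (some a) = some b

theorem ReachIn.trans {σ : Type} {f : σ → Option σ} {n n' : ℕ} {a b c : σ} (h : ReachIn f n a b)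
    (h' : ReachIn f n' b c) : ReachIn f (n + n') a c := by
  obtain ⟨j, hj, e⟩ := h
  obtain ⟨j', hj', e'⟩ := h'
  exact ⟨j' + j, by omega, by rw [Function.iterate_add_apply, e, e']⟩

theorem ReachIn.mono {σ : Type} {f : σ → Option σ} {n n' : ℕ} {a b : σ} (h : ReachIn f n a b)
    (hn : n ≤ n') : ReachIn f n' a b := by
  obtain ⟨j, hj, e⟩ := h
  exact ⟨j, hj.trans hn, e⟩

theorem ReachIn.single {σ : Type} {f : σ → Option σ} {a b : σ} (h : f a = some b) :
    ReachIn f 1 a b := ⟨1, le_rfl, h⟩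

/-- The label chosen by `popGoto`. -/
def popTarget {Λ : Type} (a b e : Λ) : List Bool → Λ
  | [] => e
  | true :: _ => a
  | false :: _ => b

theorem reachIn_popGoto {Λ : Type} {M : Λ → TStmt Λ} {k : Reg} {x a b e : Λ}
    (hx : M x = popGoto k a b e) (v : Option (Option Bool)) (i : List (Option Bool)) (s : Store) :
    ∃ v', ReachIn (TM2.step M) 1 ⟨some x, v, stk i s⟩
      ⟨some (popTarget a b e (s.get k)), v', stk i (s.set k (s.get k).tail)⟩ := by
  refine ⟨Option.map (fun x : Bool => some x) (s.get k).head?, ReachIn.single ?_⟩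
  rw [TM2.step, hx, popGoto, TM2.stepAux, TM2.stepAux, update_stk]
  change some (TM2.Cfg.mk (some (jump a b e (Option.map (fun x : Bool => some x) (s.get k).head?)))
    (Option.map (fun x : Bool => some x) (s.get k).head?)
    (stk i (s.set k (s.get k).tail))) = _
  rcases s.get k with _ | ⟨_ | _, l⟩ <;> rfl

/-- Compiled programs do what the programs do. -/
theorem Exec.reachIn {p : Cmd} {s s' : Store} {n : ℕ} (h : Exec p s n s') {Λ : Type}
    {M : Λ → TStmt Λ} {emb : p.Label → Λ} {exit : Λ}
    (hM : ∀ l, M (emb l) = p.compile emb exit l) (i : List (Option Bool))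
    (v : Option (Option Bool)) :
    ∃ v', ReachIn (TM2.step M) n ⟨some (emb p.entry), v, stk i s⟩
      ⟨some exit, v', stk i s'⟩ := by
  induction h generalizing exit v with
  | slack _ hn ih =>
    obtain ⟨v', h⟩ := ih hM v
    exact ⟨v', h.mono hn⟩
  | skip s =>
    refine ⟨v, ReachIn.single ?_⟩
    rw [TM2.step, hM]
    rfl
  | push k a s =>
    refine ⟨v, ReachIn.single ?_⟩
    rw [TM2.step, hM, ← update_stk]
    rfl
  | @seq p q s s₁ s₂ n₁ n₂ _ _ ih1 ih2 =>
    obtain ⟨v', h1⟩ := ih1 (emb := fun l => emb (.inl l)) (exit := emb (.inr q.entry))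
      (fun l => hM (.inl l)) v
    obtain ⟨v'', h2⟩ := ih2 (emb := fun l => emb (.inr l)) (exit := exit)
      (fun l => hM (.inr l)) v'
    exact ⟨v'', h1.trans h2⟩
  | @branch_true k p q s l s₁ n hk _ ih =>
    obtain ⟨v', h1⟩ := reachIn_popGoto (hM none) v i s
    obtain ⟨v'', h2⟩ := ih (emb := fun l => emb (some (.inl l))) (exit := exit)
      (fun l => hM (some (.inl l))) v'
    rw [hk] at h1
    exact ⟨v'', h1.trans h2⟩
  | @branch_false k p q s l s₁ n hk _ ih =>
    obtain ⟨v', h1⟩ := reachIn_popGoto (hM none) v i s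
    obtain ⟨v'', h2⟩ := ih (emb := fun l => emb (some (.inr l))) (exit := exit)
      (fun l => hM (some (.inr l))) v'
    rw [hk] at h1
    exact ⟨v'', h1.trans h2⟩
  | @loop_true k p s l s₁ s₂ n₁ n₂ hk _ _ ih1 ih2 =>
    obtain ⟨v', h1⟩ := reachIn_popGoto (hM none) v i s
    obtain ⟨v'', h2⟩ := ih1 (emb := fun l => emb (some l)) (exit := emb none)
      (fun l => hM (some l)) v'
    obtain ⟨v₃, h3⟩ := ih2 hM v''
    rw [hk] at h1
    exact ⟨v₃, h1.trans (h2.trans h3)⟩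
  | @loop_false k p s l hk =>
    obtain ⟨v', h1⟩ := reachIn_popGoto (hM none) v i s
    rw [hk] at h1
    exact ⟨v', h1⟩
  | @loop_nil k p s hk =>
    obtain ⟨v', h1⟩ := reachIn_popGoto (hM none) v i s
    have : s.set k (s.get k).tail = s := Store.set_tail_of_nil hk
    rw [this, hk] at h1
    exact ⟨v', h1⟩
  | @drain_true k p q s l s₁ s₂ n₁ n₂ hk _ _ ih1 ih2 =>
    obtain ⟨v', h1⟩ := reachIn_popGoto (hM none) v i s
    obtain ⟨v'', h2⟩ := ih1 (emb := fun l => emb (some (.inl l))) (exit := emb none)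
      (fun l => hM (some (.inl l))) v'
    obtain ⟨v₃, h3⟩ := ih2 hM v''
    rw [hk] at h1
    exact ⟨v₃, h1.trans (h2.trans h3)⟩
  | @drain_false k p q s l s₁ s₂ n₁ n₂ hk _ _ ih1 ih2 =>
    obtain ⟨v', h1⟩ := reachIn_popGoto (hM none) v i s
    obtain ⟨v'', h2⟩ := ih1 (emb := fun l => emb (some (.inr l))) (exit := emb none)
      (fun l => hM (some (.inr l))) v'
    obtain ⟨v₃, h3⟩ := ih2 hM v''
    rw [hk] at h1
    exact ⟨v₃, h1.trans (h2.trans h3)⟩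
  | @drain_nil k p q s hk =>
    obtain ⟨v', h1⟩ := reachIn_popGoto (hM none) v i s
    have : s.set k (s.get k).tail = s := Store.set_tail_of_nil hk
    rw [this, hk] at h1
    exact ⟨v', h1⟩

end Machine

end FloodIt

namespace FloodIt

/-! ### Programs on binary trees: pairs, case distinctions and folds. -/

section Data

/-- The data of the programs: binary trees. -/
inductive Data
  | nil
  | node (a b : Data)

/-- The prefix code of a tree. -/
def Data.code : Data → List Bool
  | .nil => [false]
  | .node a b => true :: (a.code ++ b.code)

def Data.size (x : Data) : ℕ := x.code.length

@[simp] theorem Data.size_nil : Data.nil.size = 1 := rfl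

@[simp] theorem Data.size_node (a b : Data) : (Data.node a b).size = a.size + b.size + 1 := by
  simp [Data.size, Data.code]

theorem Data.size_pos (x : Data) : 0 < x.size := by cases x <;> simp

/-- The stacks `m` and `r`, as a pair that can be swapped. -/
def mainReg : Bool → Reg
  | true => .m
  | false => .r

/-- A store given by the contents of `mainReg b`, of the other main stack, and of `t`, `u`. -/
def Store.of (b : Bool) (l o t u : List Bool) : Store :=
  match b with
  | true => ⟨l, o, t, u⟩
  | false => ⟨o, l, t, u⟩

/-- The loop of `Cmd.fetch`; the stack `u` counts the trees still to be read. -/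
def Cmd.fetchLoop (k : Reg) : Cmd :=
  .loop .u (.branch k (.seq (.push .t true) (.seq (.push .u true) (.push .u true)))
    (.push .t false))

/-- Move one tree from the stack `k` to the stack `t`, reversing its code. -/
def Cmd.fetch (k : Reg) : Cmd := .seq (.push .u true) (Cmd.fetchLoop k)

/-- The rest of the run is a hypothesis, so that the runs on the two subtrees of a node can be
chained. A node symbol takes five steps (loop test, branch, three pushes); it replaces one pending
tree on `u` by two. -/
theorem exec_fetchLoop (b : Bool) (x : Data) {l o t u : List Bool} {s : Store} {n : ℕ}
    (h : Exec (Cmd.fetchLoop (mainReg b)) (Store.of b l o (x.code.reverse ++ t) u) n s) :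
    Exec (Cmd.fetchLoop (mainReg b)) (Store.of b (x.code ++ l) o t (true :: u))
      (n + 5 * x.size) s := by
  induction x generalizing l t u n with
  | nil =>
    have h' : Exec (Cmd.fetchLoop (mainReg b)) (Store.of b (Data.nil.code ++ l) o t (true :: u))
        (1 + ((1 + 1) + n)) s := by
      cases b
      · exact Exec.loop_true rfl (Exec.branch_false rfl (Exec.push _ _ _)) h
      · exact Exec.loop_true rfl (Exec.branch_false rfl (Exec.push _ _ _)) h
    exact h'.slack (by simp; omega)
  | node x y ihx ihy =>
    have h1 : Exec (Cmd.fetchLoop (mainReg b))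
        (Store.of b l o (y.code.reverse ++ (x.code.reverse ++ (true :: t))) u) n s := by
      simpa [Data.code] using h
    have h2 := ihx (ihy h1)
    have h' : Exec (Cmd.fetchLoop (mainReg b))
        (Store.of b (true :: (x.code ++ (y.code ++ l))) o t (true :: u))
        (1 + ((1 + (1 + (1 + 1))) + (n + 5 * y.size + 5 * x.size))) s := by
      cases b
      · exact Exec.loop_true rfl (Exec.branch_true rfl ((Exec.push _ _ _).seq
          ((Exec.push _ _ _).seq (Exec.push _ _ _)))) h2
      · exact Exec.loop_true rfl (Exec.branch_true rfl ((Exec.push _ _ _).seq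
          ((Exec.push _ _ _).seq (Exec.push _ _ _)))) h2
    have := h'.slack (n' := n + 5 * (Data.node x y).size) (by simp; omega)
    simpa [Data.code] using this

theorem exec_fetch (b : Bool) (x : Data) (l o t : List Bool) :
    Exec (Cmd.fetch (mainReg b)) (Store.of b (x.code ++ l) o t []) (5 * x.size + 2)
      (Store.of b l o (x.code.reverse ++ t) []) := by
  have h : Exec (Cmd.fetchLoop (mainReg b)) (Store.of b l o (x.code.reverse ++ t) []) 1
      (Store.of b l o (x.code.reverse ++ t) []) := by
    cases b <;> exact Exec.loop_nil rfl
  have h' : Exec (Cmd.fetch (mainReg b)) (Store.of b (x.code ++ l) o t [])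
      (1 + (1 + 5 * x.size)) (Store.of b l o (x.code.reverse ++ t) []) := by
    cases b <;> exact (Exec.push _ _ _).seq (exec_fetchLoop _ x h)
  exact h'.slack (by omega)

/-- Move the stack `t` to the stack `k`. -/
def Cmd.flush (k : Reg) : Cmd := .drain .t (.push k true) (.push k false)

theorem exec_flush (b : Bool) (t l o u : List Bool) :
    Exec (Cmd.flush (mainReg b)) (Store.of b l o t u) (2 * t.length + 1)
      (Store.of b (t.reverse ++ l) o [] u) := by
  induction t generalizing l with
  | nil => cases b <;> exact Exec.drain_nil rfl
  | cons a t ih =>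
    have := ih (a :: l)
    rw [show (a :: t).reverse ++ l = t.reverse ++ a :: l by simp]
    have h : Exec (Cmd.flush (mainReg b)) (Store.of b l o (a :: t) u)
        (1 + (1 + (2 * t.length + 1))) (Store.of b (t.reverse ++ a :: l) o [] u) := by
      cases b <;> cases a
      · exact Exec.drain_false rfl (Exec.push _ _ _) this
      · exact Exec.drain_true rfl (Exec.push _ _ _) this
      · exact Exec.drain_false rfl (Exec.push _ _ _) this
      · exact Exec.drain_true rfl (Exec.push _ _ _) this
    exact h.slack (by simp; omega)

/-- Move the stack `t` to both main stacks. -/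
def Cmd.flushBoth : Cmd :=
  .drain .t (.seq (.push .m true) (.push .r true)) (.seq (.push .m false) (.push .r false))

theorem exec_flushBoth (t l o u : List Bool) :
    Exec Cmd.flushBoth ⟨l, o, t, u⟩ (3 * t.length + 1) ⟨t.reverse ++ l, t.reverse ++ o, [], u⟩ := by
  induction t generalizing l o with
  | nil => exact Exec.drain_nil rfl
  | cons a t ih =>
    have := ih (a :: l) (a :: o)
    rw [show (a :: t).reverse ++ l = t.reverse ++ a :: l by simp,
      show (a :: t).reverse ++ o = t.reverse ++ a :: o by simp]
    have h : Exec Cmd.flushBoth ⟨l, o, a :: t, u⟩ (1 + ((1 + 1) + (3 * t.length + 1)))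
        ⟨t.reverse ++ a :: l, t.reverse ++ a :: o, [], u⟩ := by
      cases a
      · exact Exec.drain_false rfl ((Exec.push _ _ _).seq (Exec.push _ _ _)) this
      · exact Exec.drain_true rfl ((Exec.push _ _ _).seq (Exec.push _ _ _)) this
    exact h.slack (by simp; omega)

/-- Empty the stack `t`. -/
def Cmd.clear : Cmd := .drain .t .skip .skip

theorem exec_clear (t l o u : List Bool) :
    Exec Cmd.clear ⟨l, o, t, u⟩ (2 * t.length + 1) ⟨l, o, [], u⟩ := by
  induction t with
  | nil => exact Exec.drain_nil rfl
  | cons a t ih =>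
    have h : Exec Cmd.clear ⟨l, o, a :: t, u⟩ (1 + (1 + (2 * t.length + 1))) ⟨l, o, [], u⟩ := by
      cases a
      · exact Exec.drain_false rfl (Exec.skip _) ih
      · exact Exec.drain_true rfl (Exec.skip _) ih
    exact h.slack (by simp; omega)

/-- Move a tree from one main stack to the other. -/
def Cmd.move (k k' : Reg) : Cmd := .seq (.fetch k) (.flush k')

theorem exec_move_mr (x : Data) (l o : List Bool) :
    Exec (.move .m .r) ⟨x.code ++ l, o, [], []⟩ (7 * x.size + 3) ⟨l, x.code ++ o, [], []⟩ := by
  have h1 := exec_fetch true x l o []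
  have h2 := exec_flush false (x.code.reverse ++ []) o l []
  simp only [List.append_nil, List.reverse_reverse, List.length_reverse] at h1 h2
  exact (h1.seq h2).slack (by simp only [Data.size]; omega)

theorem exec_move_rm (x : Data) (l o : List Bool) :
    Exec (.move .r .m) ⟨l, x.code ++ o, [], []⟩ (7 * x.size + 3) ⟨x.code ++ l, o, [], []⟩ := by
  have h1 := exec_fetch false x o l []
  have h2 := exec_flush true (x.code.reverse ++ []) l o []
  simp only [List.append_nil, List.reverse_reverse, List.length_reverse] at h1 h2
  exact (h1.seq h2).slack (by simp only [Data.size]; omega)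

/-- Copy the tree on top of the stack `m` to the stack `r`. -/
def Cmd.dup : Cmd := .seq (.fetch .m) .flushBoth

theorem exec_dup (x : Data) (l o : List Bool) :
    Exec .dup ⟨x.code ++ l, o, [], []⟩ (8 * x.size + 3) ⟨x.code ++ l, x.code ++ o, [], []⟩ := by
  have h1 := exec_fetch true x l o []
  have h2 := exec_flushBoth (x.code.reverse ++ []) l o []
  simp only [List.append_nil, List.reverse_reverse, List.length_reverse] at h1 h2
  exact (h1.seq h2).slack (by simp only [Data.size]; omega)

/-- Delete the tree on top of the stack `m`. -/
def Cmd.drop : Cmd := .seq (.fetch .m) .clear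

theorem exec_drop (x : Data) (l o : List Bool) :
    Exec .drop ⟨x.code ++ l, o, [], []⟩ (7 * x.size + 3) ⟨l, o, [], []⟩ := by
  have h1 := exec_fetch true x l o []
  have h2 := exec_clear (x.code.reverse ++ []) l o []
  simp only [List.append_nil, List.length_reverse] at h1 h2
  exact (h1.seq h2).slack (by simp only [Data.size]; omega)

/-- Push a word on the stack `m`. -/
def Cmd.pushWord : List Bool → Cmd
  | [] => .skip
  | a :: w => .seq (Cmd.pushWord w) (.push .m a)

theorem exec_pushWord (w l o : List Bool) :
    Exec (.pushWord w) ⟨l, o, [], []⟩ (w.length + 1) ⟨w ++ l, o, [], []⟩ := by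
  induction w with
  | nil => exact Exec.skip _
  | cons a w ih => exact ih.seq (Exec.push _ _ _)

/-- `Computes p x y n`: the program `p` replaces the tree `x` on top of the stack `m` by the tree
`y`, in at most `n` steps. -/
def Computes (p : Cmd) (x y : Data) (n : ℕ) : Prop :=
  ∀ l o, Exec p ⟨x.code ++ l, o, [], []⟩ n ⟨y.code ++ l, o, [], []⟩

theorem Computes.mono {p : Cmd} {x y : Data} {n n' : ℕ} (h : Computes p x y n) (hn : n ≤ n') :
    Computes p x y n' := fun l o => (h l o).slack hn

theorem Computes.size_le {p : Cmd} {x y : Data} {n : ℕ} (h : Computes p x y n) :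
    y.size ≤ x.size + n := by
  simpa [Store.size, Data.size] using (h [] []).size_le

theorem Computes.comp {p q : Cmd} {x y z : Data} {n n' : ℕ} (hp : Computes p x y n)
    (hq : Computes q y z n') : Computes (.seq p q) x z (n + n') :=
  fun l o => (hp l o).seq (hq l o)

/-- `q` runs first because the first component has to end up on top; meanwhile a copy of the input
waits on `r`. -/
def Cmd.pair (p q : Cmd) : Cmd :=
  .seq .dup (.seq q (.seq (.move .r .m) (.seq p (.push .m true))))

theorem Computes.pair {p q : Cmd} {x y z : Data} {n n' : ℕ} (hp : Computes p x y n)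
    (hq : Computes q x z n') : Computes (.pair p q) x (.node y z) (n + n' + 15 * x.size + 7) := by
  intro l o
  have := (exec_dup x l o).seq ((hq l _).seq ((exec_move_rm x _ o).seq
    ((hp _ o).seq (Exec.push .m true _))))
  simp only [Store.set, Store.get] at this
  simp only [Data.code, List.cons_append, List.append_assoc]
  exact this.slack (by omega)

def Cmd.fst : Cmd := .branch .m (.seq (.move .m .r) (.seq .drop (.move .r .m))) .skip

theorem Computes.fst (x y : Data) : Computes .fst (.node x y) x (14 * (Data.node x y).size) := by
  intro l o
  have : Exec .fst ⟨true :: (x.code ++ (y.code ++ l)), o, [], []⟩ _ _ := Exec.branch_true rfl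
    ((exec_move_mr x (y.code ++ l) o).seq ((exec_drop y l _).seq (exec_move_rm x l o)))
  simp only [Data.code, List.cons_append, List.append_assoc]
  exact this.slack (by simp; omega)

def Cmd.snd : Cmd := .branch .m .drop .skip

theorem Computes.snd (x y : Data) : Computes .snd (.node x y) y (14 * (Data.node x y).size) := by
  intro l o
  have : Exec .snd ⟨true :: (x.code ++ (y.code ++ l)), o, [], []⟩ _ _ := Exec.branch_true rfl
    (exec_drop x _ o)
  simp only [Data.code, List.cons_append, List.append_assoc]
  exact this.slack (by simp; omega)

def Cmd.const (y : Data) : Cmd := .seq .drop (.pushWord y.code)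

theorem Computes.const (x y : Data) : Computes (.const y) x y (7 * x.size + y.size + 4) :=
  fun l o => ((exec_drop x l o).seq (exec_pushWord y.code l o)).slack
    (by simp only [Data.size]; omega)

/-- Truth values as trees. -/
def Data.ofBool : Bool → Data
  | false => .nil
  | true => .node .nil .nil

def Cmd.ite (c p q : Cmd) : Cmd :=
  .seq .dup (.seq c (.branch .m
    -- `true` is coded by three symbols; the two skipping branches remove the two that the test has
    -- left behind.
    (.seq (.branch .m .skip .skip) (.seq (.branch .m .skip .skip) (.seq (.move .r .m) p)))
    (.seq (.move .r .m) q)))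

theorem Computes.ite_true {c p q : Cmd} {x y : Data} {n n' : ℕ}
    (hc : Computes c x (Data.ofBool true) n) (hp : Computes p x y n') :
    Computes (.ite c p q) x y (n + n' + 15 * x.size + 11) := by
  intro l o
  have h1 := hc l (x.code ++ o)
  have : Exec (.ite c p q) _ _ _ := (exec_dup x l o).seq (h1.seq (Exec.branch_true rfl
    ((Exec.branch_false rfl (Exec.skip _)).seq ((Exec.branch_false rfl (Exec.skip _)).seq
      ((exec_move_rm x l o).seq (hp l o))))))
  exact this.slack (by omega)

theorem Computes.ite_false {c p q : Cmd} {x y : Data} {n n' : ℕ}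
    (hc : Computes c x (Data.ofBool false) n) (hq : Computes q x y n') :
    Computes (.ite c p q) x y (n + n' + 15 * x.size + 11) := by
  intro l o
  have h1 := hc l (x.code ++ o)
  have : Exec (.ite c p q) _ _ _ := (exec_dup x l o).seq (h1.seq (Exec.branch_false rfl
    ((exec_move_rm x l o).seq (hq l o))))
  exact this.slack (by omega)

/-- Case distinction on whether a tree is `nil`. -/
def Cmd.cases (p q : Cmd) : Cmd :=
  .branch .m (.seq (.push .m true) q) (.seq (.push .m false) p)

theorem Computes.cases_nil {p q : Cmd} {y : Data} {n : ℕ} (hp : Computes p .nil y n) :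
    Computes (.cases p q) .nil y (n + 2) := fun l o =>
  Exec.slack (Exec.branch_false (l := l) rfl ((Exec.push _ _ _).seq (hp l o))) (by omega)

theorem Computes.cases_node {p q : Cmd} {x x' y : Data} {n : ℕ}
    (hq : Computes q (.node x x') y n) : Computes (.cases p q) (.node x x') y (n + 2) :=
  fun l o => Exec.slack (Exec.branch_true (l := x.code ++ x'.code ++ l) rfl
    ((Exec.push _ _ _).seq (hq l o))) (by omega)

/-- Trees as lists. -/
def Data.ofList : List Data → Data
  | [] => .nil
  | x :: l => .node x (Data.ofList l)

theorem Data.size_ofList (l : List Data) : (Data.ofList l).size = (l.map fun x => x.size + 1).sum + 1 := by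
  induction l with
  | nil => rfl
  | cons x l ih => simp only [Data.ofList, Data.size_node, ih, List.map_cons, List.sum_cons]; omega

def Cmd.foldBody (p : Cmd) : Cmd := .seq (.move .r .m) (.seq (.push .m true) p)

/-- Fold a list: `m` holds the accumulator, `r` the list. -/
def Cmd.foldLoop (p : Cmd) : Cmd := .loop .r p.foldBody

def Cmd.fold (p : Cmd) : Cmd := .branch .m (.seq (.move .m .r) p.foldLoop) .skip

/-- The code of a list has `true` in front of each entry and `false` at the end, so popping these
symbols from `r` controls the loop. The time bound `N` for `p` is required only at accumulators that
really occur. -/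
theorem exec_foldLoop {β γ : Type*} {e : β → Data} {e' : γ → Data} {p : Cmd} {g : γ → β → γ} {N : ℕ}
    {xs : List β} {c : γ} (h : ∀ ys x zs, xs = ys ++ x :: zs →
      Computes p (.node (e x) (e' (ys.foldl g c))) (e' (g (ys.foldl g c) x)) N) (l o : List Bool) :
    Exec p.foldLoop ⟨(e' c).code ++ l, (Data.ofList (xs.map e)).code ++ o, [], []⟩
      (1 + (xs.map fun x => 7 * (e x).size + 5 + N).sum) ⟨(e' (xs.foldl g c)).code ++ l, o, [], []⟩ := by
  induction xs generalizing c with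
  | nil => exact Exec.loop_false rfl
  | cons x xs ih =>
    have h1 := ih (c := g c x) fun ys x' zs e => by simpa using h (x :: ys) x' zs (by simp [e])
    have h2 := h [] x xs rfl l ((Data.ofList (xs.map e)).code ++ o)
    simp only [Data.code, List.cons_append, List.append_assoc] at h2
    have h3 : Exec p.foldBody
        ⟨(e' c).code ++ l, (e x).code ++ ((Data.ofList (xs.map e)).code ++ o), [], []⟩ _ _ :=
      (exec_move_rm (e x) ((e' c).code ++ l) _).seq ((Exec.push _ _ _).seq h2)
    have h4 : Exec p.foldLoop
        ⟨(e' c).code ++ l, true :: ((e x).code ++ ((Data.ofList (xs.map e)).code ++ o)), [], []⟩ _ _ :=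
      Exec.loop_true rfl h3 h1
    simp only [List.map_cons, Data.ofList, Data.code, List.cons_append, List.append_assoc]
    exact h4.slack (by simp only [List.sum_cons]; omega)

theorem Computes.fold {β γ : Type*} {e : β → Data} {e' : γ → Data} {p : Cmd} {g : γ → β → γ} {N : ℕ}
    {xs : List β} {c : γ} (h : ∀ ys x zs, xs = ys ++ x :: zs →
      Computes p (.node (e x) (e' (ys.foldl g c))) (e' (g (ys.foldl g c) x)) N) :
    Computes p.fold (.node (Data.ofList (xs.map e)) (e' c)) (e' (xs.foldl g c))
      ((Data.node (Data.ofList (xs.map e)) (e' c)).size * (N + 19)) := by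
  intro l o
  have h1 : Exec p.fold ⟨true :: ((Data.ofList (xs.map e)).code ++ ((e' c).code ++ l)), o, [], []⟩
      _ _ := Exec.branch_true rfl ((exec_move_mr _ _ _).seq (exec_foldLoop h l o))
  simp only [Data.code, List.cons_append, List.append_assoc]
  refine h1.slack ?_
  have h2 : (xs.map fun x => 7 * (e x).size + 5 + N).sum ≤
      (xs.map fun x => (e x).size + 1).sum * (N + 12) := by
    clear h h1
    induction xs with
    | nil => simp
    | cons x xs ih =>
      simp only [List.map_cons, List.sum_cons, add_mul ((e x).size + 1)]
      have : 7 * (e x).size + 5 + N ≤ ((e x).size + 1) * (N + 12) := by nlinarith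
      omega
  rw [Data.size_node, Data.size_ofList, List.map_map, Function.comp_def]
  nlinarith [(e' c).size_pos]

end Data

end FloodIt

namespace FloodIt

/-! ### Closure properties of polynomial-time functions. -/

section PolyTime

theorem eval_mono_nat (q : Polynomial ℕ) {a b : ℕ} (h : a ≤ b) : q.eval a ≤ q.eval b := by
  rw [Polynomial.eval_eq_sum, Polynomial.eval_eq_sum]
  exact Finset.sum_le_sum fun i _ => Nat.mul_le_mul_left _ (Nat.pow_le_pow_left h i)

/-- Types with an encoding by trees. -/
class Enc (α : Type) where
  enc : α → Data

variable {α β γ δ : Type} [Enc α] [Enc β] [Enc γ] [Enc δ]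

instance : Enc Bool := ⟨Data.ofBool⟩
instance : Enc Unit := ⟨fun _ => .nil⟩
instance : Enc (α × β) := ⟨fun x => .node (Enc.enc x.1) (Enc.enc x.2)⟩
instance : Enc (List α) := ⟨fun l => Data.ofList (l.map Enc.enc)⟩
instance : Enc ℕ := ⟨fun n => Data.ofList (List.replicate n .nil)⟩
instance : Enc (Option α) := ⟨fun x => Data.ofList (x.toList.map Enc.enc)⟩

/-- The size of the encoding. -/
def esize (a : α) : ℕ := (Enc.enc a).size

theorem esize_pair (a : α) (b : β) : esize (a, b) = esize a + esize b + 1 := Data.size_node _ _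

theorem esize_list (l : List α) : esize l = (l.map fun a => esize a + 1).sum + 1 := by
  simp only [esize, Enc.enc, Data.size_ofList, List.map_map]
  rfl

theorem esize_nat (n : ℕ) : esize n = 2 * n + 1 := by
  simp [esize, Enc.enc, Data.size_ofList, mul_comm]

theorem esize_bool (b : Bool) : esize b ≤ 3 := by cases b <;> simp [esize, Enc.enc, Data.ofBool]

/-- Functions computed in polynomial time with respect to the encodings. -/
@[fun_prop]
def PT (f : α → β) : Prop :=
  ∃ p : Cmd, ∃ q : Polynomial ℕ, ∀ a, Computes p (Enc.enc a) (Enc.enc (f a)) (q.eval (esize a))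

/-- Quantities bounded by a polynomial in the size of the encoding. -/
def PolyBdd (s : α → ℕ) : Prop := ∃ q : Polynomial ℕ, ∀ a, s a ≤ q.eval (esize a)

theorem PolyBdd.mono {s s' : α → ℕ} (h : PolyBdd s) (hs : ∀ a, s' a ≤ s a) : PolyBdd s' := by
  obtain ⟨q, hq⟩ := h
  exact ⟨q, fun a => (hs a).trans (hq a)⟩

theorem PolyBdd.const (c : ℕ) : PolyBdd fun _ : α => c := ⟨Polynomial.C c, fun a => by simp⟩

theorem PolyBdd.add {s s' : α → ℕ} (h : PolyBdd s) (h' : PolyBdd s') :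
    PolyBdd fun a => s a + s' a := by
  obtain ⟨q, hq⟩ := h
  obtain ⟨q', hq'⟩ := h'
  exact ⟨q + q', fun a => by rw [Polynomial.eval_add]; exact add_le_add (hq a) (hq' a)⟩

theorem PolyBdd.mul {s s' : α → ℕ} (h : PolyBdd s) (h' : PolyBdd s') :
    PolyBdd fun a => s a * s' a := by
  obtain ⟨q, hq⟩ := h
  obtain ⟨q', hq'⟩ := h'
  exact ⟨q * q', fun a => by rw [Polynomial.eval_mul]; exact Nat.mul_le_mul (hq a) (hq' a)⟩

theorem PolyBdd.eval {s : α → ℕ} (h : PolyBdd s) (r : Polynomial ℕ) :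
    PolyBdd fun a => r.eval (s a) := by
  obtain ⟨q, hq⟩ := h
  exact ⟨r.comp q, fun a => by rw [Polynomial.eval_comp]; exact eval_mono_nat r (hq a)⟩

theorem PolyBdd.esize : PolyBdd fun a : α => esize a := ⟨Polynomial.X, fun a => by simp⟩

theorem PT.of_polyBdd {f : α → β} {p : Cmd} {s : α → ℕ} (hs : PolyBdd s)
    (h : ∀ a, Computes p (Enc.enc a) (Enc.enc (f a)) (s a)) : PT f := by
  obtain ⟨q, hq⟩ := hs
  exact ⟨p, q, fun a => (h a).mono (hq a)⟩

theorem PT.polyBdd {f : α → β} (h : PT f) : PolyBdd fun a => FloodIt.esize (f a) := by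
  obtain ⟨p, q, h⟩ := h
  exact (PolyBdd.esize.add (PolyBdd.esize.eval q)).mono fun a => (h a).size_le

/-- A function that does not change the encoding. -/
theorem PT.of_enc_eq {f : α → β} (h : ∀ a, Enc.enc (f a) = Enc.enc a) : PT f :=
  .of_polyBdd (p := .skip) (.const 1) fun a l o => by rw [h]; exact Exec.skip _

@[fun_prop]
theorem PT.id : PT fun a : α => a := .of_enc_eq fun _ => rfl

@[fun_prop]
theorem PT.const (b : β) : PT fun _ : α => b :=
  .of_polyBdd (((PolyBdd.const 7).mul .esize).add (.const ((Enc.enc b).size + 4)))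
    fun a => (Computes.const (Enc.enc a) (Enc.enc b)).mono (by rw [← add_assoc]; rfl)

@[fun_prop]
theorem PT.comp {g : β → γ} {f : α → β} (hg : PT g) (hf : PT f) : PT fun a => g (f a) := by
  have hs := hf.polyBdd
  obtain ⟨p, q, hf⟩ := hf
  obtain ⟨p', q', hg⟩ := hg
  exact .of_polyBdd ((PolyBdd.esize.eval q).add (hs.eval q')) fun a => (hf a).comp (hg _)

@[fun_prop]
theorem PT.pair {f : α → β} {g : α → γ} (hf : PT f) (hg : PT g) : PT fun a => (f a, g a) := by
  obtain ⟨p, q, hf⟩ := hf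
  obtain ⟨p', q', hg⟩ := hg
  exact .of_polyBdd ((((PolyBdd.esize.eval q).add (.eval .esize q')).add
    ((PolyBdd.const 15).mul .esize)).add (.const 7)) fun a => (hf a).pair (hg a)

@[fun_prop]
theorem PT.fst {f : α → β × γ} (hf : PT f) : PT fun a => (f a).1 :=
  .comp (.of_polyBdd (f := Prod.fst) ((PolyBdd.const 14).mul .esize) fun _ => Computes.fst _ _) hf

@[fun_prop]
theorem PT.snd {f : α → β × γ} (hf : PT f) : PT fun a => (f a).2 :=
  .comp (.of_polyBdd (f := Prod.snd) ((PolyBdd.const 14).mul .esize) fun _ => Computes.snd _ _) hf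

@[fun_prop]
theorem PT.cond {c : α → Bool} {f g : α → β} (hc : PT c) (hf : PT f) (hg : PT g) :
    PT fun a => bif c a then f a else g a := by
  obtain ⟨p, q, hf⟩ := hf
  obtain ⟨p', q', hg⟩ := hg
  obtain ⟨p₁, q₁, hc⟩ := hc
  refine .of_polyBdd (p := .ite p₁ p p') ((((PolyBdd.esize.eval q₁).add ((PolyBdd.esize.eval q).add
    (.eval .esize q'))).add ((PolyBdd.const 15).mul .esize)).add (.const 11)) fun a => ?_
  have := hc a
  cases h : c a
  · rw [h] at this
    exact (Computes.ite_false this (hg a)).mono (by simp only [FloodIt.esize]; omega)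
  · rw [h] at this
    exact (Computes.ite_true this (hf a)).mono (by simp only [FloodIt.esize]; omega)

@[fun_prop]
theorem PT.cons {f : α → β} {g : α → List β} (hf : PT f) (hg : PT g) : PT fun a => f a :: g a :=
  -- A nonempty list and the pair of its head and tail have the same tree.
  .comp (g := fun x : β × List β => x.1 :: x.2) (.of_enc_eq fun _ => rfl) (hf.pair hg)

@[fun_prop]
theorem PT.succ {f : α → ℕ} (hf : PT f) : PT fun a => f a + 1 :=
  .comp (g := fun x : Unit × ℕ => x.2 + 1) (.of_enc_eq fun _ => rfl) ((PT.const ()).pair hf)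

/-- Case distinction on lists, for a function of a list and a parameter. -/
theorem PT.list_casesAux {f : List β → γ} {g : β × List β → γ} (hg : PT g)
    (h : ∀ b l, f (b :: l) = g (b, l)) : PT f := by
  obtain ⟨p, q, hg⟩ := hg
  refine .of_polyBdd (p := .cases (.seq .drop (.pushWord (Enc.enc (f [])).code)) p)
    ((((PolyBdd.esize.eval q).add ((PolyBdd.const 7).mul .esize))).add
      (.const ((Enc.enc (f [])).size + 4 + 2))) fun l => ?_
  rcases l with _ | ⟨b, l⟩
  · exact (Computes.cases_nil (Computes.const .nil (Enc.enc (f [])))).mono (by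
      simp only [FloodIt.esize, Enc.enc, List.map_nil, Data.ofList, Data.size_nil]; omega)
  · rw [h]
    exact (Computes.cases_node (hg (b, l))).mono (by
      rw [show FloodIt.esize (b :: l) = FloodIt.esize (b, l) from rfl]; omega)

theorem esize_le_of_mem {b : β} {l : List β} (h : b ∈ l) : esize b ≤ esize l := by
  rw [esize_list]
  have := List.single_le_sum (by simp) _ (List.mem_map_of_mem (f := fun a => esize a + 1) h)
  omega

theorem length_le_esize (l : List β) : l.length ≤ esize l := by
  rw [esize_list]
  induction l with
  | nil => simp
  | cons b l ih => simp only [List.length_cons, List.map_cons, List.sum_cons]; omega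

/-- Iterating a polynomial-time step may blow up the accumulator. A polynomial bound `s` at all
prefixes of the list gives one time bound for all rounds. -/
theorem PT.foldlAux {g : β × γ → γ} (hg : PT g) {l : α → List β} {i : α → γ} (hl : PT l)
    (hi : PT i) {s : α → ℕ} (hs : PolyBdd s) (h : ∀ a l', l' <+: l a →
      FloodIt.esize (l'.foldl (fun c b => g (b, c)) (i a)) ≤ s a) :
    PT fun a => (l a).foldl (fun c b => g (b, c)) (i a) := by
  have hpair := hl.pair hi
  have hps := hpair.polyBdd
  have hls := hl.polyBdd
  obtain ⟨p₀, q₀, h₀⟩ := hpair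
  obtain ⟨p, q, hg⟩ := hg
  refine .of_polyBdd (p := .seq p₀ p.fold) ((PolyBdd.esize.eval q₀).add
    (hps.mul ((((hls.add hs).add (.const 1)).eval q).add (.const 19)))) fun a => ?_
  refine (h₀ a).comp ?_
  have := Computes.fold (e := Enc.enc) (e' := Enc.enc) (p := p) (g := fun c b => g (b, c))
    (xs := l a) (c := i a) (N := q.eval (FloodIt.esize (l a) + s a + 1)) fun ys x zs e => by
      refine (hg (x, ys.foldl (fun c b => g (b, c)) (i a))).mono (eval_mono_nat _ ?_)
      rw [esize_pair]
      have h1 := h a ys ⟨x :: zs, e.symm⟩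
      have h2 : FloodIt.esize x ≤ FloodIt.esize (l a) := esize_le_of_mem (by simp [e])
      omega
  exact this.mono (Nat.mul_le_mul_right _ le_rfl)

/-- Folding a list, provided that the intermediate results are bounded by a polynomial. -/
theorem PT.foldl {f : α → γ → β → γ} (hf : PT fun x : α × γ × β => f x.1 x.2.1 x.2.2)
    {l : α → List β} {i : α → γ} (hl : PT l) (hi : PT i) {s : α → ℕ} (hs : PolyBdd s)
    (h : ∀ a l', l' <+: l a → FloodIt.esize (l'.foldl (f a) (i a)) ≤ s a) :
    PT fun a => (l a).foldl (f a) (i a) := by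
  -- The fold program applies a fixed function, so the parameter `a` travels inside the accumulator.
  have key : ∀ (a : α) (l : List β) (c : γ), l.foldl (fun (x : α × γ) b => (x.1, f x.1 x.2 b)) (a, c)
      = (a, l.foldl (f a) c) := by
    intro a l
    induction l with
    | nil => intro c; rfl
    | cons b l ih => intro c; simp only [List.foldl_cons, ih]
  have := PT.foldlAux (g := fun y : β × α × γ => (y.2.1, f y.2.1 y.2.2 y.1))
    (.pair (by fun_prop) (.comp (f := fun y : β × α × γ => (y.2.1, y.2.2, y.1)) hf (by fun_prop)))
    (i := fun a => (a, i a)) hl (by fun_prop) ((PolyBdd.esize.add hs).add (.const 1)) fun a l' hl' => by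
      rw [key, esize_pair]
      have := h a l' hl'
      omega
  simp only [key] at this
  exact this.snd

/-- Folding a list, when every step increases the size by a bounded amount. -/
theorem PT.foldl_of_le_add {f : α → γ → β → γ} (hf : PT fun x : α × γ × β => f x.1 x.2.1 x.2.2)
    {l : α → List β} {i : α → γ} (hl : PT l) (hi : PT i) {s : α → ℕ} (hs : PolyBdd s)
    (h : ∀ a c, ∀ b ∈ l a, FloodIt.esize (f a c b) ≤ FloodIt.esize c + s a) :
    PT fun a => (l a).foldl (f a) (i a) := by
  refine .foldl hf hl hi (hi.polyBdd.add (hl.polyBdd.mul hs)) fun a l' hl' => ?_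
  have key : ∀ (l' : List β) (c : γ), (∀ b ∈ l', b ∈ l a) →
      FloodIt.esize (l'.foldl (f a) c) ≤ FloodIt.esize c + l'.length * s a := by
    intro l'
    induction l' with
    | nil => intro c _; simp
    | cons b l' ih =>
      intro c hc
      refine (ih _ fun b hb => hc b (by simp [hb])).trans ?_
      have := h a c b (hc b (by simp))
      simp only [List.length_cons, add_mul]
      omega
  refine (key l' _ fun b hb => hl'.subset hb).trans (Nat.add_le_add_left (Nat.mul_le_mul_right _ ?_) _)
  exact hl'.length_le.trans (length_le_esize _)

/-! ### Truth values -/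

@[fun_prop]
theorem PT.and {f g : α → Bool} (hf : PT f) (hg : PT g) : PT fun a => f a && g a := by
  convert! hf.cond hg (.const false) using 2 with a
  cases f a <;> rfl

@[fun_prop]
theorem PT.or {f g : α → Bool} (hf : PT f) (hg : PT g) : PT fun a => f a || g a := by
  convert! hf.cond (.const true) hg using 2 with a

@[fun_prop]
theorem PT.not {f : α → Bool} (hf : PT f) : PT fun a => !f a := by
  convert! hf.cond (.const false) (.const true) using 2 with a

/-! ### Lists -/

@[fun_prop]
theorem PT.isEmpty {l : α → List β} (hl : PT l) : PT fun a => (l a).isEmpty :=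
  .comp (.list_casesAux (g := fun _ => false) (.const _) fun _ _ => rfl) hl

@[fun_prop]
theorem PT.tail {l : α → List β} (hl : PT l) : PT fun a => (l a).tail :=
  .comp (.list_casesAux (g := fun x => x.2) (by fun_prop) fun _ _ => rfl) hl

@[fun_prop]
theorem PT.headD {l : α → List β} (hl : PT l) (d : β) : PT fun a => (l a).headD d :=
  .comp (g := fun l => l.headD d) (.list_casesAux (g := fun x => x.1) (by fun_prop) fun _ _ => rfl) hl

theorem esize_cons (b : β) (l : List β) : esize (b :: l) = esize b + esize l + 1 := by
  simp only [esize_list, List.map_cons, List.sum_cons]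
  omega

theorem esize_append (l l' : List β) : esize (l ++ l') + 1 = esize l + esize l' := by
  simp only [esize_list, List.map_append, List.sum_append]
  omega

theorem esize_tail_le (l : List β) : esize l.tail ≤ esize l := by
  cases l
  · rfl
  · rw [esize_cons, List.tail_cons]
    omega

@[fun_prop]
theorem PT.reverse {l : α → List β} (hl : PT l) : PT fun a => (l a).reverse := by
  have : PT fun a => (l a).foldl (fun c b => b :: c) [] :=
    .foldl_of_le_add (f := fun _ c b => b :: c) (by fun_prop) hl (.const []) (hl.polyBdd.add (.const 1))
      fun a c b hb => by
        have := esize_le_of_mem hb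
        rw [esize_cons]
        omega
  simpa using this

@[fun_prop]
theorem PT.append {l l' : α → List β} (hl : PT l) (hl' : PT l') : PT fun a => l a ++ l' a := by
  have : PT fun a => (l a).reverse.foldl (fun c b => b :: c) (l' a) :=
    .foldl_of_le_add (f := fun _ c b => b :: c) (by fun_prop) hl.reverse hl' (hl.polyBdd.add (.const 1))
      fun a c b hb => by
        have := esize_le_of_mem (List.mem_reverse.1 hb)
        rw [esize_cons]
        omega
  simpa using this

theorem PT.flatMap {l : α → List β} {f : α → β → List γ} (hl : PT l)
    (hf : PT fun x : α × β => f x.1 x.2) : PT fun a => (l a).flatMap (f a) := by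
  have hfs := hf.polyBdd
  obtain ⟨q, hq⟩ := hfs
  have : PT fun a => (l a).foldl (fun c b => c ++ f a b) [] := by
    refine .foldl_of_le_add (f := fun a c b => c ++ f a b) ?_ hl (.const [])
      ((((PolyBdd.esize.add hl.polyBdd).add (.const 1)).eval q)) fun a c b hb => ?_
    · exact .append (by fun_prop) (.comp (f := fun x : α × List γ × β => (x.1, x.2.2)) hf (by fun_prop))
    · have h1 := esize_append c (f a b)
      have h2 := hq (a, b)
      rw [esize_pair] at h2
      have h3 := eval_mono_nat q (Nat.add_le_add_right (Nat.add_le_add_left (esize_le_of_mem hb)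
        (FloodIt.esize a)) 1)
      simp only at h2
      omega
  convert this using 2 with a
  have : ∀ (l : List β) (c : List γ), l.foldl (fun c b => c ++ f a b) c = c ++ l.flatMap (f a) := by
    intro l
    induction l with
    | nil => intro c; simp
    | cons b l ih => intro c; simp [ih]
  rw [this, List.nil_append]

theorem PT.map {l : α → List β} {f : α → β → γ} (hl : PT l) (hf : PT fun x : α × β => f x.1 x.2) :
    PT fun a => (l a).map (f a) := by
  have := PT.flatMap (f := fun a b => [f a b]) hl (by fun_prop)
  simpa only [← List.map_eq_flatMap] using this

theorem PT.filter {l : α → List β} {f : α → β → Bool} (hl : PT l)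
    (hf : PT fun x : α × β => f x.1 x.2) : PT fun a => (l a).filter (f a) := by
  have := PT.flatMap (f := fun a b => bif f a b then [b] else []) hl (by fun_prop)
  convert this using 2 with a
  induction l a with
  | nil => rfl
  | cons b l ih => rw [List.filter_cons, List.flatMap_cons, ← ih]; cases f a b <;> rfl

theorem PT.any {l : α → List β} {f : α → β → Bool} (hl : PT l)
    (hf : PT fun x : α × β => f x.1 x.2) : PT fun a => (l a).any (f a) := by
  have := PT.not (PT.isEmpty (PT.filter hl hf))
  convert this using 2 with a
  induction l a with
  | nil => rfl
  | cons b l ih => rw [List.any_cons, List.filter_cons, ih]; cases f a b <;> simp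

theorem PT.all {l : α → List β} {f : α → β → Bool} (hl : PT l)
    (hf : PT fun x : α × β => f x.1 x.2) : PT fun a => (l a).all (f a) := by
  have := PT.not (PT.any (f := fun a b => !f a b) hl (PT.not hf))
  convert this using 2 with a
  rw [List.not_any_eq_all_not]
  simp

/-! ### Numbers -/

@[fun_prop]
theorem PT.units {f : α → ℕ} (hf : PT f) : PT fun a => List.replicate (f a) () :=
  .comp (g := fun n => List.replicate n ()) (.of_enc_eq fun n => by
    simp only [Enc.enc, List.map_replicate]) hf

theorem foldl_replicate_unit {γ : Type} (g : γ → γ) (n : ℕ) (c : γ) :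
    (List.replicate n ()).foldl (fun c _ => g c) c = g^[n] c := by
  induction n generalizing c with
  | zero => rfl
  | succ n ih => rw [List.replicate_succ, List.foldl_cons, ih]; rfl

@[fun_prop]
theorem PT.length {l : α → List β} (hl : PT l) : PT fun a => (l a).length := by
  have : PT fun a => (l a).foldl (fun c _ => c + 1) 0 :=
    .foldl_of_le_add (f := fun _ c _ => c + 1) (by fun_prop) hl (.const 0) (.const 2)
      fun a c b _ => by simp only [esize_nat]; omega
  simpa using this

@[fun_prop]
theorem PT.add {f g : α → ℕ} (hf : PT f) (hg : PT g) : PT fun a => f a + g a := by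
  have : PT fun a => (List.replicate (f a) () ++ List.replicate (g a) ()).length := by fun_prop
  simpa using this

@[fun_prop]
theorem PT.drop {l : α → List β} {f : α → ℕ} (hf : PT f) (hl : PT l) :
    PT fun a => (l a).drop (f a) := by
  have : PT fun a => (List.replicate (f a) ()).foldl (fun c _ => c.tail) (l a) :=
    .foldl_of_le_add (f := fun _ c _ => c.tail) (by fun_prop) (by fun_prop) hl (.const 0)
      fun a c b _ => esize_tail_le c
  simpa only [foldl_replicate_unit, List.tail_iterate] using this

@[fun_prop]
theorem PT.sub {f g : α → ℕ} (hf : PT f) (hg : PT g) : PT fun a => f a - g a := by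
  have : PT fun a => ((List.replicate (f a) ()).drop (g a)).length := by fun_prop
  simpa using this

theorem PT.ble {f g : α → ℕ} (hf : PT f) (hg : PT g) : PT fun a => decide (f a ≤ g a) := by
  have : PT fun a => ((List.replicate (f a) ()).drop (g a)).isEmpty := by fun_prop
  convert this using 2 with a
  rw [Bool.eq_iff_iff]
  simp [Nat.sub_eq_zero_iff_le]

@[fun_prop]
theorem PT.nat_le {f g : α → ℕ} (hf : PT f) (hg : PT g) : PT fun a => decide (f a ≤ g a) :=
  hf.ble hg

@[fun_prop]
theorem PT.nat_beq {f g : α → ℕ} (hf : PT f) (hg : PT g) : PT fun a => f a == g a := by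
  have : PT fun a => decide (f a ≤ g a) && decide (g a ≤ f a) := by fun_prop
  convert this using 2 with a
  rw [Bool.eq_iff_iff, Bool.and_eq_true, beq_iff_eq, decide_eq_true_iff, decide_eq_true_iff]
  exact le_antisymm_iff

@[fun_prop]
theorem PT.getD {l : α → List β} {f : α → ℕ} (hl : PT l) (hf : PT f) (d : β) :
    PT fun a => (l a).getD (f a) d := by
  have : PT fun a => ((l a).drop (f a)).headD d := by fun_prop
  convert this using 2 with a
  rw [List.getD_eq_getElem?_getD, List.headD_eq_head?_getD, List.head?_drop]

theorem iterate_append_length (n : ℕ) :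
    (fun c : List ℕ => c ++ [c.length])^[n] [] = List.range n := by
  induction n with
  | zero => rfl
  | succ n ih => rw [Function.iterate_succ_apply', ih, List.range_succ, List.length_range]

theorem esize_range_le (n : ℕ) : esize (List.range n) ≤ n * (2 * n + 2) + 1 := by
  rw [esize_list]
  refine Nat.add_le_add_right ((List.sum_le_card_nsmul _ (2 * n + 2) fun x hx => ?_).trans
    (by simp)) 1
  obtain ⟨i, hi, rfl⟩ := List.mem_map.1 hx
  rw [List.mem_range] at hi
  rw [esize_nat]
  omega

@[fun_prop]
theorem PT.range {f : α → ℕ} (hf : PT f) : PT fun a => List.range (f a) := by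
  have : PT fun a => (List.replicate (f a) ()).foldl (fun (c : List ℕ) _ => c ++ [c.length]) [] := by
    -- The growth per step depends on the accumulator, so the intermediate lists, which are again
    -- ranges, are bounded directly.
    refine .foldl (f := fun _ (c : List ℕ) _ => c ++ [c.length]) (by fun_prop) (by fun_prop) (.const [])
      (s := fun a => f a * (2 * f a + 2) + 1) ?_ fun a l' hl' => ?_
    · have h : PolyBdd f := hf.polyBdd.mono fun a => by rw [esize_nat]; omega
      exact (h.mul (((PolyBdd.const 2).mul h).add (.const 2))).add (.const 1)
    · obtain ⟨k, hk, rfl⟩ : ∃ k ≤ f a, l' = List.replicate k () := by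
        refine ⟨l'.length, by simpa using hl'.length_le, List.eq_replicate_iff.2 ⟨rfl, ?_⟩⟩
        simp
      rw [foldl_replicate_unit, iterate_append_length]
      exact (esize_range_le k).trans (by gcongr)
  simpa only [foldl_replicate_unit, iterate_append_length] using this

@[fun_prop]
theorem PT.list_nat_beq {f g : α → List ℕ} (hf : PT f) (hg : PT g) : PT fun a => f a == g a := by
  have : PT fun a => (f a).length == (g a).length &&
      (List.range (f a).length).all fun i => (f a).getD i 0 == (g a).getD i 0 :=
    .and (by fun_prop) (.all (by fun_prop) (by fun_prop))
  convert this using 2 with a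
  rw [Bool.eq_iff_iff]
  simp only [beq_iff_eq, Bool.and_eq_true, List.all_eq_true, List.mem_range]
  refine ⟨fun h => by simp [h], fun ⟨h1, h2⟩ => List.ext_getElem h1 fun i hi hi' => ?_⟩
  simpa [hi, hi'] using h2 i hi

@[fun_prop]
theorem PT.min {f g : α → ℕ} (hf : PT f) (hg : PT g) : PT fun a => min (f a) (g a) := by
  have : PT fun a => f a - (f a - g a) := by fun_prop
  convert this using 2 with a
  omega

@[fun_prop]
theorem PT.sum {l : α → List ℕ} (hl : PT l) : PT fun a => (l a).sum := by
  have : PT fun a => (l a).foldl (fun c b => c + b) 0 :=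
    .foldl_of_le_add (f := fun _ c b => c + b) (by fun_prop) hl (.const 0) hl.polyBdd
      fun a c b hb => by
        have := esize_le_of_mem hb
        simp only [esize_nat] at this ⊢
        omega
  simpa [List.sum_eq_foldl] using this

end PolyTime

end FloodIt

namespace FloodIt

/-! ### Input, output and the complete Turing machine. -/

section Compile

open Turing

/-- Push a word on the stack `m`. -/
def pushStmt {Λ : Type} : List Bool → TStmt Λ → TStmt Λ
  | [], q => q
  | a :: w, q => pushStmt w (.push (some .m) (fun _ => a) q)

theorem stepAux_pushStmt {Λ : Type} (w : List Bool) (q : TStmt Λ) (v : Option (Option Bool))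
    (i : List (Option Bool)) (l o t u : List Bool) :
    TM2.stepAux (pushStmt w q) v (stk i ⟨l, o, t, u⟩) = TM2.stepAux q v (stk i ⟨w ++ l, o, t, u⟩) := by
  induction w generalizing q with
  | nil => rfl
  | cons a w ih =>
    rw [pushStmt, ih, TM2.stepAux, update_stk]
    rfl

/-- Unary numbers on `m` are converted into words on `u`. -/
def Cmd.finish : Cmd := .loop .m (.branch .m .skip (.push .u true))

/-- The code of `n` is `n` copies of `true false` followed by `false`. It is consumed entirely, as a
final configuration may have symbols only on the output stack. -/
theorem exec_finish (n : ℕ) (u : List Bool) :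
    Exec .finish ⟨(Enc.enc n).code, [], [], u⟩ (3 * n + 1) ⟨[], [], [], List.replicate n true ++ u⟩ := by
  induction n generalizing u with
  | zero => exact Exec.loop_false rfl
  | succ n ih =>
    have h1 : Exec .finish ⟨true :: false :: (Enc.enc n).code, [], [], u⟩ _ _ :=
      Exec.loop_true rfl (Exec.branch_false rfl (Exec.push _ _ _)) (ih (true :: u))
    rw [show List.replicate (n + 1) true ++ u = List.replicate n true ++ true :: u by
      simp [List.replicate_succ']]
    exact h1.slack (by omega)

/-- Labels of the machine for a program. -/
abbrev MLabel (p : Cmd) : Type := Fin 3 ⊕ p.Label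

/-- Read an input symbol and push its code, or start the program. -/
def readStmt (p : Cmd) : TStmt (MLabel p) :=
  .pop none (fun _ o => o) (.branch (fun v => v.isNone) (.goto fun _ => .inr p.entry)
    (.branch (fun v => v == some none)
      (pushStmt (true :: (Enc.enc (none : Option Bool)).code) (.goto fun _ => .inl 1))
      (.branch (fun v => v == some (some true))
        (pushStmt (true :: (Enc.enc (some true)).code) (.goto fun _ => .inl 1))
        (pushStmt (true :: (Enc.enc (some false)).code) (.goto fun _ => .inl 1)))))

/-- The code of the machine for a program. -/
def machineCode (p : Cmd) : MLabel p → TStmt (MLabel p)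
  | .inl 0 => .push (some .m) (fun _ => false) (.goto fun _ => .inl 1)
  | .inl 1 => readStmt p
  -- The halting configuration must carry the initial internal state.
  | .inl 2 => .load (fun _ => none) .halt
  | .inr l => p.compile Sum.inr (.inl 2) l

/-- The machine that reads its input onto the stack `m` and then runs a program. -/
def machine (p : Cmd) : FinTM2 where
  K := Option Reg
  k₀ := none
  k₁ := some .u
  Γ := Alph
  Λ := MLabel p
  main := .inl 0
  σ := Option (Option Bool)
  initialState := none
  Γk₀Fin := inferInstanceAs (Fintype (Option Bool))
  m := machineCode p

theorem update_stk_none (i i' : List (Option Bool)) (s : Store) :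
    Function.update (stk i s) none i' = stk i' s := by
  funext k
  rcases k with _ | k
  · exact Function.update_self _ _ _
  · exact Function.update_of_ne (by simp) _ _

/-- Symbols are put in front of a list as they are read, so the program receives the input word
reversed. -/
theorem reachIn_read (p : Cmd) (w : List (Option Bool)) (l : List (Option Bool))
    (v : Option (Option Bool)) :
    ReachIn (TM2.step (machineCode p)) (w.length + 1)
      ⟨some (.inl 1), v, stk w ⟨(Enc.enc l).code, [], [], []⟩⟩
      ⟨some (.inr p.entry), none, stk [] ⟨(Enc.enc (w.reverse ++ l)).code, [], [], []⟩⟩ := by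
  induction w generalizing l v with
  | nil =>
    refine ReachIn.single ?_
    rw [TM2.step, machineCode, readStmt, TM2.stepAux, update_stk_none]
    rfl
  | cons x w ih =>
    have h := ih (x :: l) (some x)
    rw [show (x :: w).reverse ++ l = w.reverse ++ x :: l by simp]
    refine ((ReachIn.single (b := ⟨some (.inl 1), some x,
      stk w ⟨(Enc.enc (x :: l)).code, [], [], []⟩⟩) ?_).trans h).mono (by simp; omega)
    rw [TM2.step, machineCode, readStmt, TM2.stepAux, update_stk_none]
    rcases x with _ | _ | _
    · have := stepAux_pushStmt (Λ := MLabel p) (true :: (Enc.enc (none : Option Bool)).code)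
        (.goto fun _ => Sum.inl (1 : Fin 3)) (some none) w (Enc.enc l).code [] [] []
      exact congrArg some this
    · have := stepAux_pushStmt (Λ := MLabel p) (true :: (Enc.enc (some false)).code)
        (.goto fun _ => Sum.inl (1 : Fin 3)) (some (some false)) w (Enc.enc l).code [] [] []
      exact congrArg some this
    · have := stepAux_pushStmt (Λ := MLabel p) (true :: (Enc.enc (some true)).code)
        (.goto fun _ => Sum.inl (1 : Fin 3)) (some (some true)) w (Enc.enc l).code [] [] []
      exact congrArg some this

theorem reachIn_machine {p : Cmd} {w : List (Option Bool)} {k n : ℕ}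
    (h : Computes p (Enc.enc w.reverse) (Enc.enc k) n) :
    ReachIn (TM2.step (machineCode (.seq p .finish))) (w.length + n + 3 * k + 4)
      ⟨some (.inl 0), none, stk w ⟨[], [], [], []⟩⟩
      ⟨none, none, stk [] ⟨[], [], [], List.replicate k true⟩⟩ := by
  let M := machineCode (.seq p .finish)
  have h0 : ReachIn (TM2.step M) 1 ⟨some (.inl 0), none, stk w ⟨[], [], [], []⟩⟩
      ⟨some (.inl 1), none, stk w ⟨(Enc.enc ([] : List (Option Bool))).code, [], [], []⟩⟩ := by
    refine ReachIn.single ?_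
    rw [TM2.step]
    have := stepAux_pushStmt (Λ := MLabel (.seq p .finish)) [false]
      (.goto fun _ => Sum.inl (1 : Fin 3)) none w [] [] [] []
    exact congrArg some this
  have h1 := reachIn_read (.seq p .finish) w [] none
  have h2 := h [] []
  have h3 := exec_finish k []
  simp only [List.append_nil] at h1 h2 h3
  obtain ⟨v, h4⟩ := (h2.seq h3).reachIn (M := M) (emb := Sum.inr) (exit := .inl 2)
    (fun _ => rfl) [] none
  have h5 : ReachIn (TM2.step M) 1 ⟨some (.inl 2), v, stk [] ⟨[], [], [], List.replicate k true⟩⟩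
      ⟨none, none, stk [] ⟨[], [], [], List.replicate k true⟩⟩ := ReachIn.single rfl
  exact (h0.trans (h1.trans (h4.trans h5))).mono (by omega)

theorem unaryEncodeNat_eq (n : ℕ) : Computability.unaryEncodeNat n = List.replicate n true := by
  induction n with
  | zero => rfl
  | succ n ih => rw [Computability.unaryEncodeNat, ih, List.replicate_succ]

theorem esize_word_le (w : List (Option Bool)) : esize w ≤ 6 * w.length + 1 := by
  rw [esize_list]
  refine Nat.add_le_add_right ((List.sum_le_card_nsmul _ 6 fun x hx => ?_).trans
    (by simp [mul_comm])) 1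
  obtain ⟨x, -, rfl⟩ := List.mem_map.1 hx
  rcases x with _ | _ | _ <;> simp [esize, Enc.enc, Data.ofList, Data.ofBool]

/-- Functions in `PT` are computed by Turing machines in polynomial time. -/
theorem PT.nonempty_computable {α : Type} [Enc α] {ea : α → List (Option Bool)} {f : α → ℕ}
    (hf : PT f) (h : ∀ a, Enc.enc a = Enc.enc (ea a).reverse) :
    Nonempty (TM2ComputableInPolyTime ea Computability.unaryEncodeNat f) := by
  obtain ⟨r, hr⟩ := hf.polyBdd
  obtain ⟨p, q, hp⟩ := hf
  refine ⟨{ tm := machine (.seq p .finish)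
            inputAlphabet := Equiv.refl _
            outputAlphabet := Equiv.refl _
            -- `X` is for reading, `q` for the program and `3 * r` for the unary output; a word of
            -- length `m` has an encoding of size at most `6 * m + 1`.
            time := .X + (q + 3 * r).comp (6 * .X + 1) + 4
            outputsFun := fun a => Classical.choice ?_ }⟩
  have hp' := hp a
  rw [h a] at hp'
  obtain ⟨j, hj, e⟩ := reachIn_machine hp'
  refine ⟨⟨⟨j, ?_⟩, ?_⟩⟩
  · refine Eq.trans (congrArg _ ?_) (e.trans ?_)
    · refine congrArg some ?_
      rw [initList]
      congr 1
      funext k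
      rcases k with _ | _ | _ | _ | _
      · exact List.map_id _
      all_goals rfl
    · refine congrArg some ?_
      rw [haltList]
      congr 1
      funext k
      rcases k with _ | _ | _ | _ | _
      any_goals rfl
      refine (unaryEncodeNat_eq (f a)).symm.trans (List.map_id _).symm
  · refine hj.trans ?_
    have h1 : esize a ≤ 6 * (ea a).length + 1 := by
      have := esize_word_le (ea a).reverse
      rw [List.length_reverse] at this
      rwa [esize, h a]
    have h2 := eval_mono_nat q h1
    have h3 := (hr a).trans (eval_mono_nat r h1)
    simp only [esize_nat] at h3
    simp only [Polynomial.eval_add, Polynomial.eval_comp, Polynomial.eval_mul, Polynomial.eval_X,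
      Polynomial.eval_ofNat, Polynomial.eval_one]
    omega

end Compile

end FloodIt

namespace FloodIt

/-! ### The saturation algorithm and its polynomial-time building blocks. -/

section Algorithm

variable {α : Type} [Enc α]

/-- A fact `(A, d, k)`: the vertices in the list `A` can be given colour `d` at cost `k`. -/
abbrev Fact : Type := List ℕ × ℕ × ℕ

/-- Add a symbol in front of a list of words, `none` being a separator. -/
def splitStep (c : List (List Bool)) (s : Option Bool) : List (List Bool) :=
  bif s.toList.isEmpty then [] :: c else (s.toList.headD false :: c.headD []) :: c.tail

/-- The words of a reversed input. -/
def splitWords (w : List (Option Bool)) : List (List Bool) := w.foldl splitStep [[]]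

/-- Layout of `W` for a graph on `n` vertices: words 0 and 1 give the numbers of vertices and
colours, words `2` to `n + 1` the adjacency rows, words `n + 2` to `2n + 1` the colours; a target
colour is word `2n + 2`. -/
def numVertices (W : List (List Bool)) : ℕ := (W.getD 0 []).length

def numColours (W : List (List Bool)) : ℕ := (W.getD 1 []).length

def adjBit (W : List (List Bool)) (i j : ℕ) : Bool := (W.getD (i + 2) []).getD j false

def colourNum (W : List (List Bool)) (i : ℕ) : ℕ := (W.getD (numVertices W + 2 + i) []).length

def memBit (A : List ℕ) (i : ℕ) : Bool := A.any fun j => j == i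

def factBeq (x y : Fact) : Bool := x.1 == y.1 && (x.2.1 == y.2.1 && x.2.2 == y.2.2)

def linkBit (W : List (List Bool)) (A B : List ℕ) : Bool := A.any fun i => B.any fun j => adjBit W i j

def unionList (W : List (List Bool)) (A B : List ℕ) : List ℕ :=
  (List.range (numVertices W)).filter fun i => memBit A i || memBit B i

def initFacts (W : List (List Bool)) : List Fact :=
  (List.range (numVertices W)).map fun v => ([v], colourNum W v, 0)

/-- Costs above `n` may be discarded: `n` moves always suffice, and subderivations cost no more than
the whole. -/
def recolourFacts (W : List (List Bool)) (x : Fact) : List Fact :=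
  bif decide (x.2.2 + 1 ≤ numVertices W) then
    (List.range (numColours W)).map fun d => (x.1, d, x.2.2 + 1) else []

/-- Disjointness is not tested; overlapping unions are still sound, by way of `CDer.merge`. -/
def joinFacts (W : List (List Bool)) (x y : Fact) : List Fact :=
  bif x.2.1 == y.2.1 && (decide (x.2.2 + y.2.2 ≤ numVertices W) && linkBit W x.1 y.1) then
    [(unionList W x.1 y.1, x.2.1, x.2.2 + y.2.2)] else []

def newFacts (W : List (List Bool)) (L : List Fact) : List Fact :=
  L ++ L.flatMap fun x => recolourFacts W x ++ L.flatMap fun y => joinFacts W x y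

/-- Without the removal of repetitions the length of the list could be squared in every round. -/
def dedupFacts (L : List Fact) : List Fact :=
  L.foldl (fun c x => bif c.any (fun y => factBeq x y) then c else x :: c) []

/-- One round of the saturation. -/
def stepFacts (W : List (List Bool)) (L : List Fact) : List Fact := dedupFacts (newFacts W L)

def allFacts (W : List (List Bool)) : List Fact :=
  (List.replicate (numVertices W + numVertices W) ()).foldl (fun L _ => stepFacts W L) (initFacts W)

def closedBit (W : List (List Bool)) (A : List ℕ) : Bool :=
  A.all fun i => (List.range (numVertices W)).all fun j => !adjBit W i j || memBit A j

/-- In a list without repetitions this selects exactly one fact for each pair of a set and a colour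
that occurs. -/
def minimalBit (L : List Fact) (x : Fact) : Bool :=
  L.all fun y => !(y.1 == x.1 && y.2.1 == x.2.1) || decide (x.2.2 ≤ y.2.2)

/-- The sum, over all connected components, of the cheapest costs for colour `d`. -/
def totalCost (W : List (List Bool)) (L : List Fact) (d : ℕ) : ℕ :=
  ((L.filter fun x => x.2.1 == d && (closedBit W x.1 && minimalBit L x)).map fun x => x.2.2).sum

/-- The starting value does no harm, since `floodNumber` never exceeds the number of vertices. -/
def minTotalCost (W : List (List Bool)) (L : List Fact) : ℕ :=
  (List.range (numColours W)).foldl (fun m d => min m (totalCost W L d)) (numVertices W)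

theorem PT.splitStep : PT fun x : List (List Bool) × Option Bool => splitStep x.1 x.2 := by
  unfold FloodIt.splitStep
  have h : PT fun x : List (List Bool) × Option Bool => x.2.toList :=
    .comp (g := fun s : Option Bool => s.toList) (.of_enc_eq fun s => rfl) (by fun_prop)
  fun_prop

@[fun_prop]
theorem PT.splitWords {w : α → List (Option Bool)} (hw : PT w) : PT fun a => splitWords (w a) := by
  refine .foldl_of_le_add (f := fun _ c s => FloodIt.splitStep c s) ?_ hw (.const _) (.const 8)
    fun a c s _ => ?_
  · exact .comp (f := fun x : α × List (List Bool) × Option Bool => x.2) PT.splitStep (by fun_prop)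
  · rcases s with _ | b
    · simp only [FloodIt.splitStep, Option.toList_none, List.isEmpty_nil, cond_true]
      rw [esize_cons, show esize ([] : List Bool) = 1 from rfl]
      omega
    · have hb := esize_bool b
      simp only [FloodIt.splitStep, Option.toList_some, List.isEmpty_cons, cond_false, List.headD_cons]
      rcases c with _ | ⟨x, c⟩
      · rw [List.headD_nil, List.tail_nil, esize_cons, esize_cons,
          show esize ([] : List Bool) = 1 from rfl, show esize ([] : List (List Bool)) = 1 from rfl]
        omega
      · rw [List.headD_cons, List.tail_cons, esize_cons, esize_cons, esize_cons]
        omega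

@[fun_prop]
theorem PT.numVertices {W : α → List (List Bool)} (hW : PT W) : PT fun a => numVertices (W a) := by
  unfold FloodIt.numVertices; fun_prop

@[fun_prop]
theorem PT.numColours {W : α → List (List Bool)} (hW : PT W) : PT fun a => numColours (W a) := by
  unfold FloodIt.numColours; fun_prop

@[fun_prop]
theorem PT.adjBit {W : α → List (List Bool)} (hW : PT W) {i j : α → ℕ} (hi : PT i) (hj : PT j) :
    PT fun a => adjBit (W a) (i a) (j a) := by
  unfold FloodIt.adjBit; fun_prop

@[fun_prop]
theorem PT.colourNum {W : α → List (List Bool)} (hW : PT W) {i : α → ℕ} (hi : PT i) :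
    PT fun a => colourNum (W a) (i a) := by
  unfold FloodIt.colourNum; fun_prop

@[fun_prop]
theorem PT.memBit {A : α → List ℕ} (hA : PT A) {i : α → ℕ} (hi : PT i) :
    PT fun a => memBit (A a) (i a) :=
  .any hA (by fun_prop)

@[fun_prop]
theorem PT.factBeq {x y : α → Fact} (hx : PT x) (hy : PT y) : PT fun a => factBeq (x a) (y a) := by
  unfold FloodIt.factBeq; fun_prop

@[fun_prop]
theorem PT.linkBit {W : α → List (List Bool)} (hW : PT W) {A B : α → List ℕ} (hA : PT A)
    (hB : PT B) : PT fun a => linkBit (W a) (A a) (B a) :=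
  .any (f := fun a i => (B a).any fun j => FloodIt.adjBit (W a) i j) hA
    (.any (f := fun (x : α × ℕ) j => FloodIt.adjBit (W x.1) x.2 j) (by fun_prop) (by fun_prop))

@[fun_prop]
theorem PT.unionList {W : α → List (List Bool)} (hW : PT W) {A B : α → List ℕ} (hA : PT A)
    (hB : PT B) : PT fun a => unionList (W a) (A a) (B a) :=
  .filter (f := fun a i => FloodIt.memBit (A a) i || FloodIt.memBit (B a) i) (by fun_prop) (by fun_prop)

@[fun_prop]
theorem PT.initFacts {W : α → List (List Bool)} (hW : PT W) : PT fun a => initFacts (W a) :=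
  .map (f := fun a v => ([v], FloodIt.colourNum (W a) v, 0)) (by fun_prop) (by fun_prop)

@[fun_prop]
theorem PT.recolourFacts {W : α → List (List Bool)} (hW : PT W) {x : α → Fact} (hx : PT x) :
    PT fun a => recolourFacts (W a) (x a) :=
  .cond (by fun_prop) (.map (f := fun a d => ((x a).1, d, (x a).2.2 + 1)) (by fun_prop) (by fun_prop))
    (.const _)

@[fun_prop]
theorem PT.joinFacts {W : α → List (List Bool)} (hW : PT W) {x y : α → Fact} (hx : PT x)
    (hy : PT y) : PT fun a => joinFacts (W a) (x a) (y a) := by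
  unfold FloodIt.joinFacts; fun_prop

@[fun_prop]
theorem PT.newFacts {W : α → List (List Bool)} (hW : PT W) {L : α → List Fact} (hL : PT L) :
    PT fun a => newFacts (W a) (L a) :=
  .append hL (.flatMap (f := fun a x => FloodIt.recolourFacts (W a) x ++
    (L a).flatMap fun y => FloodIt.joinFacts (W a) x y) hL (.append (by fun_prop)
      (.flatMap (f := fun (z : α × Fact) y => FloodIt.joinFacts (W z.1) z.2 y)
        (by fun_prop) (by fun_prop))))

@[fun_prop]
theorem PT.dedupFacts {L : α → List Fact} (hL : PT L) : PT fun a => dedupFacts (L a) := by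
  refine .foldl_of_le_add (f := fun _ c x => bif c.any (fun y => FloodIt.factBeq x y) then c else x :: c)
    ?_ hL (.const _) (hL.polyBdd.add (.const 1)) fun a c b hb => ?_
  · exact .cond (.any (f := fun (z : α × List Fact × Fact) y => FloodIt.factBeq z.2.2 y) (by fun_prop)
      (by fun_prop)) (by fun_prop) (by fun_prop)
  · have := esize_le_of_mem hb
    cases c.any (fun y => FloodIt.factBeq b y)
    · rw [cond_false, esize_cons]; omega
    · rw [cond_true]; omega

@[fun_prop]
theorem PT.stepFacts {W : α → List (List Bool)} (hW : PT W) {L : α → List Fact} (hL : PT L) :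
    PT fun a => stepFacts (W a) (L a) := by
  unfold FloodIt.stepFacts; fun_prop

@[fun_prop]
theorem PT.closedBit {W : α → List (List Bool)} (hW : PT W) {A : α → List ℕ} (hA : PT A) :
    PT fun a => closedBit (W a) (A a) :=
  .all (f := fun a i => (List.range (FloodIt.numVertices (W a))).all fun j =>
      !FloodIt.adjBit (W a) i j || FloodIt.memBit (A a) j) hA
    (.all (f := fun (x : α × ℕ) j => !FloodIt.adjBit (W x.1) x.2 j || FloodIt.memBit (A x.1) j)
      (by fun_prop) (by fun_prop))

@[fun_prop]
theorem PT.minimalBit {L : α → List Fact} (hL : PT L) {x : α → Fact} (hx : PT x) :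
    PT fun a => minimalBit (L a) (x a) :=
  PT.all (β := Fact) (f := fun a y => !(y.1 == (x a).1 && y.2.1 == (x a).2.1) || decide ((x a).2.2 ≤ y.2.2)) hL
    (by fun_prop)

@[fun_prop]
theorem PT.totalCost {W : α → List (List Bool)} (hW : PT W) {L : α → List Fact} (hL : PT L)
    {d : α → ℕ} (hd : PT d) : PT fun a => totalCost (W a) (L a) (d a) :=
  .sum (.map (f := fun _ x => x.2.2) (.filter (f := fun a x => x.2.1 == d a &&
    (FloodIt.closedBit (W a) x.1 && FloodIt.minimalBit (L a) x)) hL (by fun_prop)) (by fun_prop))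

@[fun_prop]
theorem PT.minTotalCost {W : α → List (List Bool)} (hW : PT W) {L : α → List Fact} (hL : PT L) :
    PT fun a => minTotalCost (W a) (L a) := by
  refine .foldl_of_le_add (f := fun a m d => Min.min m (FloodIt.totalCost (W a) (L a) d)) (by fun_prop)
    (by fun_prop) (by fun_prop) (.const 0) fun a c b _ => ?_
  simp only [esize_nat]
  omega

theorem allFacts_eq (W : List (List Bool)) :
    allFacts W = (stepFacts W)^[numVertices W + numVertices W] (initFacts W) :=
  foldl_replicate_unit _ _ _

/-- The size bound stays a hypothesis because it is here that the restriction to `𝒢_p` enters. -/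
theorem PT.allFacts {W : α → List (List Bool)} (hW : PT W) {s : α → ℕ} (hs : PolyBdd s)
    (h : ∀ a k, esize ((FloodIt.stepFacts (W a))^[k] (FloodIt.initFacts (W a))) ≤ s a) :
    PT fun a => allFacts (W a) := by
  refine .foldl (f := fun a L _ => FloodIt.stepFacts (W a) L) (by fun_prop) (by fun_prop)
    (by fun_prop) hs fun a l' hl' => ?_
  obtain ⟨k, rfl⟩ : ∃ k, l' = List.replicate k () :=
    ⟨_, List.eq_replicate_iff.2 ⟨rfl, fun _ _ => rfl⟩⟩
  rw [foldl_replicate_unit]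
  exact h a k

end Algorithm

end FloodIt

namespace FloodIt

/-! ### The saturation computes the flood numbers. -/

section Correctness

/-- The list of words `W` represents a coloured graph. -/
structure Represents (W : List (List Bool)) (I : ColouredGraph) : Prop where
  numVertices : numVertices W = I.n
  numColours : numColours W = I.c
  adj : ∀ i j : Fin I.n, adjBit W i j = true ↔ I.G.Adj i j
  colour : ∀ i : Fin I.n, colourNum W i = I.ω i

open Classical in
/-- The increasing list of the elements of a set of vertices. -/
noncomputable def canon {n : ℕ} (S : Set (Fin n)) : List ℕ :=
  (List.range n).filter fun i => decide (∃ h : i < n, (⟨i, h⟩ : Fin n) ∈ S)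

theorem mem_canon {n : ℕ} {S : Set (Fin n)} {i : ℕ} :
    i ∈ canon S ↔ ∃ h : i < n, (⟨i, h⟩ : Fin n) ∈ S := by
  simp only [canon, List.mem_filter, List.mem_range, decide_eq_true_iff]
  exact ⟨fun h => h.2, fun h => ⟨h.1, h⟩⟩

theorem val_mem_canon {n : ℕ} {S : Set (Fin n)} {i : Fin n} : (i : ℕ) ∈ canon S ↔ i ∈ S := by
  simp [mem_canon]

theorem canon_injective {n : ℕ} : Function.Injective (canon (n := n)) := by
  intro S T h
  ext i
  rw [← val_mem_canon, h, val_mem_canon]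

theorem memBit_iff {A : List ℕ} {i : ℕ} : memBit A i = true ↔ i ∈ A := by
  simp [memBit]

theorem factBeq_iff {x y : Fact} : factBeq x y = true ↔ x = y := by
  simp [factBeq, Prod.ext_iff]

theorem dedupFacts_spec (L : List Fact) :
    (dedupFacts L).Nodup ∧ ∀ x, x ∈ dedupFacts L ↔ x ∈ L := by
  suffices H : ∀ (L c : List Fact), c.Nodup →
      (L.foldl (fun c x => bif c.any (fun y => factBeq x y) then c else x :: c) c).Nodup ∧
      ∀ x, x ∈ L.foldl (fun c x => bif c.any (fun y => factBeq x y) then c else x :: c) c ↔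
        x ∈ L ∨ x ∈ c by
    obtain ⟨h1, h2⟩ := H L [] List.nodup_nil
    exact ⟨h1, fun x => (h2 x).trans (by simp)⟩
  intro L
  induction L with
  | nil => intro c hc; simpa using hc
  | cons z L ih =>
    intro c hc
    rw [List.foldl_cons]
    cases h : c.any (fun y => factBeq z y)
    · have hz : z ∉ c := fun hz => by
        have : c.any (fun y => factBeq z y) = true :=
          List.any_eq_true.2 ⟨z, hz, factBeq_iff.2 rfl⟩
        rw [h] at this
        exact Bool.noConfusion this
      rw [cond_false]
      obtain ⟨h1, h2⟩ := ih (z :: c) (List.nodup_cons.2 ⟨hz, hc⟩)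
      refine ⟨h1, fun x => ?_⟩
      rw [h2, List.mem_cons, List.mem_cons]
      tauto
    · rw [cond_true]
      obtain ⟨h1, h2⟩ := ih c hc
      refine ⟨h1, fun x => ?_⟩
      obtain ⟨y, hy, hzy⟩ := List.any_eq_true.1 h
      rw [factBeq_iff] at hzy
      subst hzy
      rw [h2, List.mem_cons]
      constructor
      · tauto
      · rintro ((rfl | h) | h) <;> tauto

variable {W : List (List Bool)} {I : ColouredGraph}

theorem canon_singleton {n : ℕ} (v : Fin n) : canon {v} = [(v : ℕ)] := by
  have h1 : (canon {v}).Nodup := List.nodup_range.filter _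
  have h2 : canon {v} ⊆ [(v : ℕ)] := fun i hi => by
    obtain ⟨h, hi⟩ := mem_canon.1 hi
    simp [← Set.mem_singleton_iff.1 hi]
  rcases (List.subperm_of_subset h1 h2).length_le with h
  have h3 : (v : ℕ) ∈ canon {v} := val_mem_canon.2 rfl
  match hc : canon {v} with
  | [] => rw [hc] at h3; simp at h3
  | [a] => rw [hc] at h3; simpa using (List.mem_singleton.1 h3).symm
  | a :: b :: l => rw [hc] at h; simp at h

open Classical in
theorem filter_eq_canon {n : ℕ} {S : Set (Fin n)} {f : ℕ → Bool}
    (h : ∀ i, f i = true ↔ ∃ h : i < n, (⟨i, h⟩ : Fin n) ∈ S) : (List.range n).filter f = canon S := by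
  refine List.filter_congr fun i _ => ?_
  rw [Bool.eq_iff_iff, h, decide_eq_true_iff]

theorem unionList_canon (hW : Represents W I) (S T : Set (Fin I.n)) :
    unionList W (canon S) (canon T) = canon (S ∪ T) := by
  rw [unionList, hW.numVertices]
  refine filter_eq_canon fun i => ?_
  rw [Bool.or_eq_true, memBit_iff, memBit_iff, mem_canon, mem_canon, ← exists_or]
  exact Iff.rfl

theorem linkBit_canon (hW : Represents W I) (S T : Set (Fin I.n)) :
    linkBit W (canon S) (canon T) = true ↔ ∃ a ∈ S, ∃ b ∈ T, I.G.Adj a b := by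
  simp only [linkBit, List.any_eq_true]
  constructor
  · rintro ⟨i, hi, j, hj, h⟩
    obtain ⟨hi, hi'⟩ := mem_canon.1 hi
    obtain ⟨hj, hj'⟩ := mem_canon.1 hj
    exact ⟨_, hi', _, hj', (hW.adj ⟨i, hi⟩ ⟨j, hj⟩).1 h⟩
  · rintro ⟨a, ha, b, hb, h⟩
    exact ⟨a, val_mem_canon.2 ha, b, val_mem_canon.2 hb, (hW.adj a b).2 h⟩

theorem closedBit_canon (hW : Represents W I) (S : Set (Fin I.n)) :
    closedBit W (canon S) = true ↔ ∀ a ∈ S, ∀ b, I.G.Adj a b → b ∈ S := by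
  simp only [closedBit, List.all_eq_true, hW.numVertices, List.mem_range, Bool.or_eq_true,
    Bool.not_eq_true', memBit_iff]
  constructor
  · intro h a ha b hab
    rcases h a (val_mem_canon.2 ha) b b.2 with h | h
    · rw [(hW.adj a b).2 hab] at h
      exact absurd h (by simp)
    · exact val_mem_canon.1 h
  · intro h i hi j hj
    obtain ⟨hi, hi'⟩ := mem_canon.1 hi
    by_cases hA : adjBit W i j = true
    · exact Or.inr (mem_canon.2 ⟨hj, h _ hi' ⟨j, hj⟩ ((hW.adj ⟨i, hi⟩ ⟨j, hj⟩).1 hA)⟩)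
    · exact Or.inl (by simpa using hA)

theorem minimalBit_iff {L : List Fact} {x : Fact} :
    minimalBit L x = true ↔ ∀ y ∈ L, y.1 = x.1 → y.2.1 = x.2.1 → x.2.2 ≤ y.2.2 := by
  simp only [minimalBit, List.all_eq_true, Bool.or_eq_true, Bool.not_eq_true', Bool.and_eq_false_iff,
    decide_eq_true_iff, beq_eq_false_iff_ne]
  refine forall₂_congr fun y _ => ?_
  tauto

/-- The facts that occur in the algorithm. -/
def Good (I : ColouredGraph) (x : Fact) : Prop :=
  ∃ (S : Set (Fin I.n)) (d : Fin I.c), x.1 = canon S ∧ x.2.1 = d ∧ x.2.2 ≤ I.n ∧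
    Der I.G I.ω S d x.2.2 ∧ (I.G.induce S).Connected

theorem mem_newFacts {L : List Fact} {x : Fact} : x ∈ newFacts W L ↔
    x ∈ L ∨ ∃ y ∈ L, x ∈ recolourFacts W y ∨ ∃ z ∈ L, x ∈ joinFacts W y z := by
  simp only [newFacts, List.mem_append, List.mem_flatMap]

theorem mem_recolourFacts (hW : Represents W I) {x y : Fact} : x ∈ recolourFacts W y ↔
    y.2.2 + 1 ≤ I.n ∧ ∃ d < I.c, x = (y.1, d, y.2.2 + 1) := by
  rw [recolourFacts, hW.numVertices, hW.numColours]
  by_cases h : y.2.2 + 1 ≤ I.n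
  · simp only [h, decide_true, cond_true, List.mem_map, List.mem_range, true_and]
    exact exists_congr fun d => and_congr_right fun _ => eq_comm
  · simp [h]

theorem mem_joinFacts (hW : Represents W I) {x y z : Fact} : x ∈ joinFacts W y z ↔
    (y.2.1 = z.2.1 ∧ y.2.2 + z.2.2 ≤ I.n ∧ linkBit W y.1 z.1 = true) ∧
      x = (unionList W y.1 z.1, y.2.1, y.2.2 + z.2.2) := by
  rw [joinFacts, hW.numVertices]
  cases h : (y.2.1 == z.2.1 && (decide (y.2.2 + z.2.2 ≤ I.n) && linkBit W y.1 z.1))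
  · rw [cond_false]
    refine iff_of_false (by simp) fun h' => ?_
    have := h'.1
    simp_all
  · rw [cond_true, List.mem_singleton]
    simp only [Bool.and_eq_true, beq_iff_eq, decide_eq_true_iff] at h
    tauto

theorem good_initFacts (hW : Represents W I) {x : Fact} (hx : x ∈ initFacts W) : Good I x := by
  rw [initFacts, hW.numVertices, List.mem_map] at hx
  obtain ⟨v, hv, rfl⟩ := hx
  rw [List.mem_range] at hv
  refine ⟨{⟨v, hv⟩}, I.ω ⟨v, hv⟩, (canon_singleton (⟨v, hv⟩ : Fin I.n)).symm, hW.colour ⟨v, hv⟩, Nat.zero_le _,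
    Der.leaf _ _ rfl ?_, ?_⟩
  · rintro _ rfl
    exact mem_comp_self _
  · have : Unique ({⟨v, hv⟩} : Set (Fin I.n)) := Set.uniqueSingleton _
    exact SimpleGraph.Connected.of_subsingleton

/-- Sets are united only along an edge, so they stay connected; this is what keeps the facts few. -/
theorem good_newFacts (hW : Represents W I) {L : List Fact} (hL : ∀ x ∈ L, Good I x) {x : Fact}
    (hx : x ∈ newFacts W L) : Good I x := by
  rcases mem_newFacts.1 hx with hx | ⟨y, hy, hx | ⟨z, hz, hx⟩⟩
  · exact hL x hx
  · obtain ⟨hk, d, hd, rfl⟩ := (mem_recolourFacts hW).1 hx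
    obtain ⟨S, e, h1, h2, h3, h4, h5⟩ := hL y hy
    exact ⟨S, ⟨d, hd⟩, h1, rfl, hk, h4.recolour _, h5⟩
  · obtain ⟨⟨hd, hk, hl⟩, rfl⟩ := (mem_joinFacts hW).1 hx
    obtain ⟨S, e, h1, h2, h3, h4, h5⟩ := hL y hy
    obtain ⟨T, e', h1', h2', h3', h4', h5'⟩ := hL z hz
    obtain rfl : e = e' := Fin.ext (by rw [← h2, ← h2', hd])
    rw [h1, h1'] at hl ⊢
    obtain ⟨a, ha, b, hb, hab⟩ := (linkBit_canon hW S T).1 hl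
    exact ⟨S ∪ T, e, unionList_canon hW S T, h2, hk, h4.join h4' ⟨a, ha, b, hb, Or.inr hab⟩,
      SimpleGraph.connected_induce_union h5.preconnected h5'.preconnected ha hb hab⟩

theorem iterate_stepFacts_spec (hW : Represents W I) (r : ℕ) :
    ((stepFacts W)^[r] (initFacts W)).Nodup ∧ ∀ x ∈ (stepFacts W)^[r] (initFacts W), Good I x := by
  induction r with
  | zero =>
    refine ⟨?_, fun x hx => good_initFacts hW hx⟩
    refine List.nodup_range.map fun i j h => ?_
    simpa using congrArg Prod.fst h
  | succ r ih =>
    rw [Function.iterate_succ_apply']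
    refine ⟨(dedupFacts_spec _).1, fun x hx => ?_⟩
    exact good_newFacts hW ih.2 (((dedupFacts_spec _).2 x).1 hx)

theorem mem_stepFacts {L : List Fact} {x : Fact} : x ∈ stepFacts W L ↔ x ∈ newFacts W L :=
  (dedupFacts_spec _).2 x

theorem DerD.nonempty {V C : Type*} {G : SimpleGraph V} {ω : V → C} {S : Set V} {d : C} {k : ℕ}
    (h : DerD G ω S d k) : S.Nonempty := by
  induction h with
  | single v => exact Set.singleton_nonempty v
  | recolour _ _ ih => exact ih
  | join _ _ _ _ ih _ => exact ih.inl

/-- `|S| + k` drops by at least one from a conclusion to each premise: a recolouring adds one to the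
cost, and a union of disjoint nonempty sets adds a vertex to either side. The round in which a fact
has appeared is bounded accordingly. -/
theorem mem_iterate_of_derD (hW : Represents W I) {S : Set (Fin I.n)} {d : Fin I.c} {k : ℕ}
    (h : DerD I.G I.ω S d k) (hk : k ≤ I.n) {r : ℕ} (hr : S.ncard + k ≤ r + 1) :
    ((canon S, (d : ℕ), k) : Fact) ∈ (stepFacts W)^[r] (initFacts W) := by
  induction h generalizing r with
  | single v =>
    induction r with
    | zero =>
      refine List.mem_map.2 ⟨v, ?_, ?_⟩
      · rw [hW.numVertices]
        exact List.mem_range.2 v.2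
      · rw [hW.colour, canon_singleton]
    | succ r ih =>
      rw [Function.iterate_succ_apply', mem_stepFacts, mem_newFacts]
      exact Or.inl (ih (by simp))
  | @recolour A d k d' hA ih =>
    have := (Set.ncard_pos (Set.toFinite _)).2 hA.nonempty
    obtain ⟨r, rfl⟩ : ∃ r', r = r' + 1 := ⟨r - 1, by omega⟩
    rw [Function.iterate_succ_apply', mem_stepFacts, mem_newFacts]
    exact Or.inr ⟨_, ih (by omega) (r := r) (by omega),
      Or.inl ((mem_recolourFacts hW).2 ⟨hk, d', d'.2, rfl⟩)⟩
  | @join A B d k l hA hB hd hl ihA ihB =>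
    have h1 := (Set.ncard_pos (Set.toFinite _)).2 hA.nonempty
    have h2 := (Set.ncard_pos (Set.toFinite _)).2 hB.nonempty
    rw [Set.ncard_union_eq hd (Set.toFinite _) (Set.toFinite _)] at hr
    obtain ⟨r, rfl⟩ : ∃ r', r = r' + 1 := ⟨r - 1, by omega⟩
    rw [Function.iterate_succ_apply', mem_stepFacts, mem_newFacts]
    refine Or.inr ⟨_, ihA (by omega) (r := r) (by omega), Or.inr ⟨_, ihB (by omega) (r := r)
      (by omega), (mem_joinFacts hW).2 ⟨⟨rfl, hk, (linkBit_canon hW A B).2 hl⟩, ?_⟩⟩⟩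
    rw [unionList_canon hW]

theorem floodNumber_le_card {V C : Type*} [Fintype V] (G : SimpleGraph V) (ω : V → C) (d : C) :
    floodNumber G ω d ≤ Fintype.card V := by
  refine Nat.sInf_le ⟨Finset.univ.toList.map fun u => (u, d), by simp,
    fun v => playSeq_eq_of_mem G d _ ω v (Or.inl (by simp))⟩

theorem supp_of_closed {V : Type*} {G : SimpleGraph V} {S : Set V} (hS : (G.induce S).Connected)
    (hc : ∀ a ∈ S, ∀ b, G.Adj a b → b ∈ S) : ∃ K : G.ConnectedComponent, S = K.supp := by
  obtain ⟨⟨v, hv⟩⟩ := hS.nonempty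
  refine ⟨G.connectedComponentMk v, Set.ext fun u => ?_⟩
  rw [SimpleGraph.ConnectedComponent.mem_supp_iff, SimpleGraph.ConnectedComponent.eq]
  constructor
  · intro hu
    exact (hS.preconnected ⟨u, hu⟩ ⟨v, hv⟩).map (SimpleGraph.Embedding.induce S).toHom
  · rintro ⟨p⟩
    have := p.reverse
    clear p
    induction this with
    | nil => exact hv
    | cons h _ ih => exact ih (hc _ hv _ h)

open Classical in
/-- The algorithm computes `m_G(G, ω, d)`. -/
theorem totalCost_eq (hW : Represents W I) (d : Fin I.c) :
    totalCost W (allFacts W) d = floodNumber I.G I.ω d := by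
  have := Fintype.ofFinite I.G.ConnectedComponent
  set L := allFacts W with hL
  have hLs := iterate_stepFacts_spec hW (numVertices W + numVertices W)
  rw [← allFacts_eq, ← hL] at hLs
  obtain ⟨S, hS, hSd⟩ := Nat.sInf_mem (floodNumber_set_nonempty I.G I.ω d)
  change S.length = floodNumber I.G I.ω d at hS
  obtain ⟨κ, hκ, hder⟩ := exists_derD_of_playSeq hSd
  -- The costs come from an optimal sequence, so they respect the cap `n`, and `2n` rounds reach
  -- every component by `hmem`.
  have hκle : ∀ K, κ K ≤ I.n := fun K => by
    have h1 := floodNumber_le_card I.G I.ω d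
    have h2 := Finset.single_le_sum (f := κ) (fun _ _ => Nat.zero_le _) (Finset.mem_univ K)
    rw [Fintype.card_fin] at h1
    omega
  have hmem : ∀ K, ((canon K.supp, (d : ℕ), κ K) : Fact) ∈ L := fun K => by
    rw [hL, allFacts_eq, hW.numVertices]
    refine mem_iterate_of_derD hW (hder K) (hκle K) ?_
    have h1 := Set.ncard_le_card (K.supp)
    have h2 := hκle K
    simp only [Nat.card_eq_fintype_card, Fintype.card_fin] at h1
    omega
  have hex : ∀ K : I.G.ConnectedComponent, ∃ k, ((canon K.supp, (d : ℕ), k) : Fact) ∈ L :=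
    fun K => ⟨_, hmem K⟩
  let φ : I.G.ConnectedComponent → Fact := fun K => (canon K.supp, d, Nat.find (hex K))
  have hφ : ∀ K, φ K ∈ L := fun K => Nat.find_spec (hex K)
  have hφmin : ∀ K k, ((canon K.supp, (d : ℕ), k) : Fact) ∈ L → (φ K).2.2 ≤ k :=
    fun K k hk => Nat.find_min' (hex K) hk
  have htot : totalCost W L d = ∑ K, (φ K).2.2 := by
    rw [totalCost, ← List.sum_toFinset _ (hLs.1.filter _)]
    -- The facts passing the filter are exactly the values of `φ`: a connected closed set is a
    -- connected component, and minimality leaves only its cheapest cost.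
    refine (Finset.sum_nbij φ ?_ ?_ ?_ fun _ _ => rfl).symm
    · intro K _
      rw [List.mem_toFinset, List.mem_filter]
      refine ⟨hφ K, ?_⟩
      rw [Bool.and_eq_true, Bool.and_eq_true, minimalBit_iff, closedBit_canon hW]
      refine ⟨by simp [φ], fun a ha b hab => ?_, fun y hy h1 h2 => ?_⟩
      · exact (SimpleGraph.ConnectedComponent.connectedComponentMk_eq_of_adj hab).symm.trans ha
      · refine hφmin K _ ?_
        convert hy using 1
        exact Prod.ext h1.symm (Prod.ext h2.symm rfl)
    · intro K _ K' _ h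
      exact SimpleGraph.ConnectedComponent.supp_injective (canon_injective (congrArg Prod.fst h))
    · intro x hx
      rw [Finset.mem_coe, List.mem_toFinset, List.mem_filter, Bool.and_eq_true, Bool.and_eq_true,
        minimalBit_iff, beq_iff_eq] at hx
      obtain ⟨hx, hxd, hxc, hxm⟩ := hx
      obtain ⟨S, e, h1, h2, h3, h4, h5⟩ := hLs.2 x hx
      rw [h1, closedBit_canon hW] at hxc
      obtain ⟨K, rfl⟩ := supp_of_closed h5 hxc
      refine ⟨K, Finset.mem_coe.2 (Finset.mem_univ _), ?_⟩
      refine Prod.ext h1.symm (Prod.ext hxd.symm (le_antisymm (hφmin K _ ?_) (hxm _ (hφ K) h1.symm hxd.symm)))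
      convert hx using 1
      exact Prod.ext h1.symm (Prod.ext hxd.symm rfl)
  rw [htot]
  apply le_antisymm
  · rw [← hS, ← hκ]
    exact Finset.sum_le_sum fun K _ => hφmin K _ (hmem K)
  -- Conversely, the cheapest derivations of the components are played one after the other.
  · obtain ⟨T, hT, -, hTd⟩ := exists_playSeq_of_components (G := I.G) (ω := I.ω) (d := d) Finset.univ
      (fun K => (φ K).2.2) fun K _ => by
        obtain ⟨S, e, h1, h2, h3, h4, h5⟩ := hLs.2 _ (hφ K)
        obtain rfl := canon_injective h1
        obtain rfl := Fin.ext h2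
        exact h4
    rw [← hT]
    exact Nat.sInf_le ⟨T, rfl, fun v => hTd v (Finset.mem_univ _)⟩

theorem foldl_min_spec (g : ℕ → ℕ) (l : List ℕ) (m : ℕ) :
    l.foldl (fun m d => min m (g d)) m ≤ m ∧ (∀ d ∈ l, l.foldl (fun m d => min m (g d)) m ≤ g d) ∧
      (l.foldl (fun m d => min m (g d)) m = m ∨
        ∃ d ∈ l, l.foldl (fun m d => min m (g d)) m = g d) := by
  induction l generalizing m with
  | nil => simp
  | cons a l ih =>
    obtain ⟨h1, h2, h3⟩ := ih (min m (g a))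
    rw [List.foldl_cons]
    refine ⟨h1.trans (min_le_left _ _), ?_, ?_⟩
    · intro d hd
      rcases List.mem_cons.1 hd with rfl | hd
      · exact h1.trans (min_le_right _ _)
      · exact h2 d hd
    · rcases h3 with h3 | ⟨d, hd, h3⟩
      · rcases min_choice m (g a) with h | h
        · exact Or.inl (h3.trans h)
        · exact Or.inr ⟨a, by simp, h3.trans h⟩
      · exact Or.inr ⟨d, by simp [hd], h3⟩

/-- The algorithm computes `m_G(G, ω)`. -/
theorem minTotalCost_eq (hW : Represents W I) :
    minTotalCost W (allFacts W) = minFloodNumber I.G I.ω := by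
  have : Nonempty (Fin I.c) := ⟨⟨0, I.c_pos⟩⟩
  obtain ⟨h1, h2, h3⟩ := foldl_min_spec (totalCost W (allFacts W)) (List.range (numColours W))
    (numVertices W)
  rw [minTotalCost, minFloodNumber]
  rw [hW.numColours] at h1 h2 h3 ⊢
  apply le_antisymm
  · refine le_ciInf fun d => ?_
    rw [← totalCost_eq hW d]
    exact h2 d (List.mem_range.2 d.2)
  · rcases h3 with h3 | ⟨d, hd, h3⟩
    · rw [h3, hW.numVertices]
      refine (ciInf_le (OrderBot.bddBelow _) ⟨0, I.c_pos⟩).trans ?_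
      simpa using floodNumber_le_card I.G I.ω ⟨0, I.c_pos⟩
    · rw [List.mem_range] at hd
      rw [h3, totalCost_eq hW ⟨d, hd⟩]
      exact ciInf_le (OrderBot.bddBelow _) _

end Correctness

end FloodIt

namespace FloodIt

/-! ### Decoding the input word. -/

section Encoding

theorem splitWords_reverse_cons (s : Option Bool) (w : List (Option Bool)) :
    splitWords (s :: w).reverse = splitStep (splitWords w.reverse) s := by
  simp [splitWords, List.foldl_append]

/-- Reading backwards, a separator opens a new word and the letters in front of it are prepended to
that word. The initial `[[]]` only leaves an empty word at the very end. -/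
theorem splitWords_word (l : List Bool) (w : List (Option Bool)) :
    splitWords (l.map some ++ none :: w).reverse = l :: splitWords w.reverse := by
  induction l with
  | nil => exact splitWords_reverse_cons none w
  | cons b l ih =>
    rw [List.map_cons, List.cons_append, splitWords_reverse_cons, ih]
    rfl

theorem splitWords_flatMap {β : Type} (xs : List β) (f : β → List Bool) (w : List (Option Bool)) :
    splitWords ((xs.flatMap fun x => (f x).map some ++ [none]) ++ w).reverse =
      xs.map f ++ splitWords w.reverse := by
  induction xs with
  | nil => rfl
  | cons x xs ih =>
    rw [List.flatMap_cons, List.append_assoc, List.append_assoc, List.singleton_append, splitWords_word,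
      ih, List.map_cons, List.cons_append]

theorem unaryWord_eq (k : ℕ) : unaryWord k = (List.replicate k true).map some ++ [none] := by
  simp [unaryWord]

open Classical in
theorem splitWords_encode (I : ColouredGraph) (w : List (Option Bool)) :
    splitWords (I.encode ++ w).reverse =
      List.replicate I.n true :: List.replicate I.c true ::
        ((List.finRange I.n).map (fun u => (List.finRange I.n).map fun v => decide (I.G.Adj u v)) ++
          ((List.finRange I.n).map (fun v => List.replicate (I.ω v : ℕ) true) ++
            splitWords w.reverse)) := by
  rw [ColouredGraph.encode]
  simp only [unaryWord_eq, List.append_assoc, List.cons_append, List.nil_append]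
  rw [splitWords_word, splitWords_word]
  have hrow : (fun u : Fin I.n => (List.finRange I.n).map (fun v => some (decide (I.G.Adj u v))) ++ [none]) =
      fun u => ((List.finRange I.n).map fun v => decide (I.G.Adj u v)).map some ++ [none] :=
    funext fun u => by rw [List.map_map, Function.comp_def]
  rw [hrow, splitWords_flatMap, splitWords_flatMap]

theorem represents_splitWords (I : ColouredGraph) (w : List (Option Bool)) :
    Represents (splitWords (I.encode ++ w).reverse) I := by
  classical
  have hn : numVertices (splitWords (I.encode ++ w).reverse) = I.n := by
    rw [splitWords_encode, numVertices, List.getD_cons_zero, List.length_replicate]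
  refine ⟨hn, ?_, fun i j => ?_, fun i => ?_⟩
  · rw [splitWords_encode, numColours, List.getD_cons_succ, List.getD_cons_zero,
      List.length_replicate]
  · rw [splitWords_encode, adjBit, List.getD_cons_succ, List.getD_cons_succ,
      List.getD_append _ _ _ _ (by simp)]
    simp
  · rw [colourNum, hn, splitWords_encode, show I.n + 2 + (i : ℕ) = I.n + i + 1 + 1 by omega,
      List.getD_cons_succ, List.getD_cons_succ, List.getD_append_right _ _ _ _ (by simp),
      List.getD_append _ _ _ _ (by simp)]
    simp

theorem targetColour_splitWords (I : TargetedColouredGraph) :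
    ((splitWords I.encode.reverse).getD (I.n + I.n + 2) []).length = I.d := by
  rw [TargetedColouredGraph.encode, splitWords_encode, List.getD_cons_succ, List.getD_cons_succ,
    List.getD_append_right _ _ _ _ (by simp), List.getD_append_right _ _ _ _ (by simp), unaryWord_eq,
    splitWords_word]
  simp

end Encoding

/-! ### Polynomial bounds for the lists of facts. -/

section SizeBound

variable {W : List (List Bool)} {I : ColouredGraph}

theorem esize_canon_le {n : ℕ} (S : Set (Fin n)) : esize (canon S) ≤ n * (2 * n + 2) + 1 := by
  rw [esize_list]
  refine Nat.add_le_add_right ((List.sum_le_card_nsmul _ (2 * n + 2) fun x hx => ?_).trans ?_) 1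
  · obtain ⟨i, hi, rfl⟩ := List.mem_map.1 hx
    obtain ⟨hi, -⟩ := mem_canon.1 hi
    rw [esize_nat]
    omega
  · rw [List.length_map, smul_eq_mul]
    exact Nat.mul_le_mul_right _ ((List.length_filter_le _ _).trans (by simp))

theorem esize_good_le {x : Fact} (hx : Good I x) :
    esize x ≤ I.n * (2 * I.n + 2) + 2 * I.c + 2 * I.n + 5 := by
  obtain ⟨S, d, h1, h2, h3, -, -⟩ := hx
  obtain ⟨A, e, k⟩ := x
  simp only at h1 h2 h3
  subst h1
  have := esize_canon_le S
  have := d.2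
  rw [esize_pair, esize_pair, esize_nat, esize_nat]
  omega

/-- A fact is determined by a connected set, a colour and a cost between `0` and `n`, because sets
are stored as their canonical lists. -/
theorem length_facts_le {L : List Fact} (hL : L.Nodup) (h : ∀ x ∈ L, Good I x) :
    L.length ≤ numConnectedSubgraphs I.G * (I.c * (I.n + 1)) := by
  classical
  have hfin : {A : Set (Fin I.n) | (I.G.induce A).Connected}.Finite := Set.toFinite _
  have hsub : L.toFinset ⊆ (hfin.toFinset.image canon) ×ˢ (Finset.range I.c ×ˢ Finset.range (I.n + 1)) := by
    intro x hx
    obtain ⟨S, d, h1, h2, h3, -, h5⟩ := h x (List.mem_toFinset.1 hx)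
    rw [Finset.mem_product, Finset.mem_product, Finset.mem_range, Finset.mem_range, h1, h2]
    exact ⟨Finset.mem_image_of_mem _ (hfin.mem_toFinset.2 h5), d.2, by omega⟩
  have := Finset.card_le_card hsub
  rw [List.toFinset_card_of_nodup hL, Finset.card_product, Finset.card_product, Finset.card_range,
    Finset.card_range] at this
  refine this.trans (Nat.mul_le_mul_right _ (Finset.card_image_le.trans ?_))
  rw [numConnectedSubgraphs, Set.ncard_eq_toFinset_card _ hfin]

theorem esize_facts_le (hW : Represents W I) (r : ℕ) :
    esize ((stepFacts W)^[r] (initFacts W)) ≤ numConnectedSubgraphs I.G * (I.c * (I.n + 1)) *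
      (I.n * (2 * I.n + 2) + 2 * I.c + 2 * I.n + 6) + 1 := by
  obtain ⟨h1, h2⟩ := iterate_stepFacts_spec hW r
  rw [esize_list]
  refine Nat.add_le_add_right ((List.sum_le_card_nsmul _
    (I.n * (2 * I.n + 2) + 2 * I.c + 2 * I.n + 6) fun y hy => ?_).trans ?_) 1
  · obtain ⟨x, hx, rfl⟩ := List.mem_map.1 hy
    have := esize_good_le (h2 x hx)
    omega
  · rw [List.length_map, smul_eq_mul]
    exact Nat.mul_le_mul_right _ (length_facts_le h1 h2)

/-- A real polynomial is bounded on natural numbers by a polynomial with natural coefficients. -/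
theorem exists_nat_polynomial_bound (p : Polynomial ℝ) :
    ∃ q : Polynomial ℕ, ∀ n : ℕ, p.eval (n : ℝ) ≤ (q.eval n : ℕ) := by
  induction p using Polynomial.induction_on' with
  | add p p' h h' =>
    obtain ⟨q, hq⟩ := h
    obtain ⟨q', hq'⟩ := h'
    exact ⟨q + q', fun n => by
      rw [Polynomial.eval_add, Polynomial.eval_add, Nat.cast_add]
      exact add_le_add (hq n) (hq' n)⟩
  | monomial k a =>
    refine ⟨Polynomial.monomial k ⌈a⌉₊, fun n => ?_⟩
    rw [Polynomial.eval_monomial, Polynomial.eval_monomial, Nat.cast_mul, Nat.cast_pow]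
    gcongr
    exact Nat.le_ceil a

end SizeBound

/-! ### Assembly of the two algorithms. -/

section Main

variable {α : Type} [Enc α]

/-- The saturation runs in polynomial time on the class `𝒢_p`. -/
theorem PT.allFacts_of_inClass {p : Polynomial ℝ} {W : α → List (List Bool)} (hW : PT W)
    {I : α → ColouredGraph} (hI : ∀ a, Represents (W a) (I a)) (hp : ∀ a, (I a).InClass p) :
    PT fun a => FloodIt.allFacts (W a) := by
  obtain ⟨q, hq⟩ := exists_nat_polynomial_bound p
  have hn : PolyBdd fun a => (I a).n := (PT.numVertices hW).polyBdd.mono fun a => by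
    rw [esize_nat, (hI a).numVertices]; omega
  have hc : PolyBdd fun a => (I a).c := (PT.numColours hW).polyBdd.mono fun a => by
    rw [esize_nat, (hI a).numColours]; omega
  -- This number is never computed: `PolyBdd` asks only for a bound, and membership in `𝒢_p` gives
  -- one.
  have hN : PolyBdd fun a => numConnectedSubgraphs (I a).G := (hn.eval q).mono fun a => by
    exact_mod_cast (hp a).trans (hq _)
  refine PT.allFacts hW (s := fun a => numConnectedSubgraphs (I a).G * ((I a).c * ((I a).n + 1)) *
    ((I a).n * (2 * (I a).n + 2) + 2 * (I a).c + 2 * (I a).n + 6) + 1) ?_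
    fun a k => esize_facts_le (hI a) k
  exact (((hN.mul (hc.mul (hn.add (.const 1)))).mul ((((hn.mul (((PolyBdd.const 2).mul hn).add
    (.const 2))).add ((PolyBdd.const 2).mul hc)).add ((PolyBdd.const 2).mul hn)).add (.const 6))).add
    (.const 1))

theorem computable_floodNumber (p : Polynomial ℝ) :
    Nonempty (Turing.TM2ComputableInPolyTime
      (fun I : {I : TargetedColouredGraph // I.toColouredGraph.InClass p} => I.1.encode)
      Computability.unaryEncodeNat
      (fun I => floodNumber I.1.G I.1.ω I.1.d)) := by
  -- Inputs are encoded as the tree that the machine holds after reading, the list of the reversed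
  -- word, so that obtaining this word costs nothing.
  let : Enc {I : TargetedColouredGraph // I.toColouredGraph.InClass p} :=
    ⟨fun I => Enc.enc I.1.encode.reverse⟩
  have hW : PT fun I : {I : TargetedColouredGraph // I.toColouredGraph.InClass p} =>
      splitWords I.1.encode.reverse := PT.splitWords (.of_enc_eq fun _ => rfl)
  have hr : ∀ I : {I : TargetedColouredGraph // I.toColouredGraph.InClass p},
      Represents (splitWords I.1.encode.reverse) I.1.toColouredGraph :=
    fun I => represents_splitWords _ _
  have hL := PT.allFacts_of_inClass hW hr fun I => I.2
  have hd : PT fun I : {I : TargetedColouredGraph // I.toColouredGraph.InClass p} =>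
      ((splitWords I.1.encode.reverse).getD (numVertices (splitWords I.1.encode.reverse) +
        numVertices (splitWords I.1.encode.reverse) + 2) []).length := by fun_prop
  refine PT.nonempty_computable ?_ fun _ => rfl
  convert! PT.totalCost hW hL hd using 2 with I
  rw [(hr I).numVertices, targetColour_splitWords, totalCost_eq (hr I)]

theorem computable_minFloodNumber (p : Polynomial ℝ) :
    Nonempty (Turing.TM2ComputableInPolyTime
      (fun I : {I : ColouredGraph // I.InClass p} => I.1.encode)
      Computability.unaryEncodeNat
      (fun I => minFloodNumber I.1.G I.1.ω)) := by
  let : Enc {I : ColouredGraph // I.InClass p} := ⟨fun I => Enc.enc I.1.encode.reverse⟩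
  have hW : PT fun I : {I : ColouredGraph // I.InClass p} => splitWords I.1.encode.reverse :=
    PT.splitWords (.of_enc_eq fun _ => rfl)
  have hr : ∀ I : {I : ColouredGraph // I.InClass p},
      Represents (splitWords I.1.encode.reverse) I.1 := fun I => by
    simpa using represents_splitWords I.1 []
  have hL := PT.allFacts_of_inClass hW hr fun I => I.2
  refine PT.nonempty_computable ?_ fun _ => rfl
  convert! PT.minTotalCost hW hL using 2 with I
  rw [minTotalCost_eq (hr I)]

end Main

end FloodIt

theorem mainTheorem5 (p : Polynomial ℝ) :
    Nonempty (Turing.TM2ComputableInPolyTime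
      (fun I : {I : FloodIt.TargetedColouredGraph // I.toColouredGraph.InClass p} => I.1.encode)
      Computability.unaryEncodeNat
      (fun I => FloodIt.floodNumber I.1.G I.1.ω I.1.d)) ∧
    Nonempty (Turing.TM2ComputableInPolyTime
      (fun I : {I : FloodIt.ColouredGraph // I.InClass p} => I.1.encode)
      Computability.unaryEncodeNat
      (fun I => FloodIt.minFloodNumber I.1.G I.1.ω)) :=
  ⟨FloodIt.computable_floodNumber p, FloodIt.computable_minFloodNumber p⟩
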